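/- Let $k\ge 2$ and $n\ge 1$ be integers, let $p\in(0,1)$ and $q=1-p$. Each of $k$ boxes initially contains $n$ matches. People arrive one after another; independently, each is a big-chooser with probability $p$ and a little-chooser with probability $q$. A big-chooser removes a match from a box that currently contains the most matches, a little-chooser from a box that currently contains the fewest, ties being broken by any fixed rule. Let $M_n=M_n^{(k)}(p)$ be the expected total number of matches in the other $k-1$ boxes at the moment when a box first becomes empty. For $i\ge1$ let $s_i^{(k)}$ be the number of lattice paths from $((k-1)i,i)$ to $(0,0)$ with unit south and west steps that lie strictly below the line $(k-1)y-x=0$ except at their two endpoints. Put $S^{(k)}(z)=\sum_{i\ge1}s_i^{(k)}z^i$, $\lambda_{k,p}=\frac1q S^{(k)}(p^{k-1}q)$ and $$R^*=\frac{(k-1)^{k-1}}{k^k}\cdot\frac1{p^{k-1}q}.$$ Fix $k$ and $p$. Then, as $n\to\infty$: - If $q>1/k$, then $\lambda_{k,p}\in(0,1)$ and, for every $\epsilon>0$, $$M_n=\Big(k-\frac1q\Big)n+\frac pq\cdot\frac1{1-\lambda_{k,p}}+O\Big(\Big(\frac1{R^*}+\epsilon\Big)^n\Big).$$ - If $q=1/k$,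 then $M_n\sim\sqrt{\dfrac{2k(k-1)n}{\pi}}$; more precisely, $$M_n=\sqrt{\frac{2k(k-1)n}{\pi}}+\frac{k-2}{3}+O\Big(\frac1{n^{1/2}}\Big).$$ - If $q<1/k$, then, for every $\epsilon>0$, $$M_n=\frac{(k-1)(2-kq)}{2(1-kq)}+O\Big(\Big(\frac1{R^*}+\epsilon\Big)^n\Big).$$ -/

import Mathlib

open MeasureTheory ProbabilityTheory Filter Asymptotics

noncomputable section

/-- A rule telling a big-chooser which box to use: always a box holding the most matches
(ties are broken in whatever way the rule prescribes). -/
def IsBigRule {k : ℕ} (r : (Fin k → ℕ) → Fin k) : Prop :=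
  ∀ (a : Fin k → ℕ) (j : Fin k), a j ≤ a (r a)

/-- A rule telling a little-chooser which box to use: always a box holding the fewest matches. -/
def IsLittleRule {k : ℕ} (r : (Fin k → ℕ) → Fin k) : Prop :=
  ∀ (a : Fin k → ℕ) (j : Fin k), a (r a) ≤ a j

/-- Contents of the `k` boxes after `t` arrivals, each box starting with `n` matches. The `t`-th
person is a big-chooser if `c t = true` and a little-chooser if `c t = false`. -/
def boxes {k : ℕ} (big little : (Fin k → ℕ) → Fin k) (n : ℕ) (c : ℕ → Bool) : ℕ → (Fin k → ℕ)
  | 0 => fun _ => n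
  | t + 1 =>
    let a := boxes big little n c t
    let j := if c t = true then big a else little a
    Function.update a j (a j - 1)

/-- The first time at which some box is empty. -/
def emptyTime {k : ℕ} (big little : (Fin k → ℕ) → Fin k) (n : ℕ) (c : ℕ → Bool) : ℕ :=
  sInf {t : ℕ | ∃ j : Fin k, boxes big little n c t j = 0}

/-- The residue: the total number of matches left when a box first becomes empty
(the empty box contributes `0`, so this is the content of the other `k - 1` boxes). -/
def residue {k : ℕ} (big little : (Fin k → ℕ) → Fin k) (n : ℕ) (c : ℕ → Bool) : ℕ :=
  ∑ j : Fin k, boxes big little n c (emptyTime big little n c) j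

/-- The expected residue when the sequence of arrivals is the random sequence `ξ`. -/
def expectedResidue {Ω : Type*} [MeasurableSpace Ω] (μ : Measure Ω) (ξ : ℕ → Ω → Bool)
    {k : ℕ} (big little : (Fin k → ℕ) → Fin k) (n : ℕ) : ℝ :=
  ∫ ω, (residue big little n (fun t => ξ t ω) : ℝ) ∂μ

/-- A word `w` of length `k * i` codes a lattice path starting at `((k - 1) * i, i)`: the letter
`true` is a unit step west and `false` is a unit step south. This is the abscissa after `t`
steps. -/
def pathX (k i : ℕ) (w : Fin (k * i) → Bool) (t : ℕ) : ℤ :=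
  ((k : ℤ) - 1) * i - (Finset.univ.filter fun j : Fin (k * i) => j.val < t ∧ w j = true).card

/-- The ordinate of the path coded by `w` after `t` steps. -/
def pathY (k i : ℕ) (w : Fin (k * i) → Bool) (t : ℕ) : ℤ :=
  (i : ℤ) - (Finset.univ.filter fun j : Fin (k * i) => j.val < t ∧ w j = false).card

/-- The path ends at the origin, and lies strictly below the line `(k - 1) y - x = 0`
except at its two endpoints. -/
def IsFirstReturnPath (k i : ℕ) (w : Fin (k * i) → Bool) : Prop :=
  pathX k i w (k * i) = 0 ∧ pathY k i w (k * i) = 0 ∧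
    ∀ t ∈ Finset.Ioo 0 (k * i), ((k : ℤ) - 1) * pathY k i w t - pathX k i w t < 0

/-- The number of first diagonal returns of order `i`. -/
def firstReturnCount (k i : ℕ) : ℕ :=
  Set.ncard {w : Fin (k * i) → Bool | IsFirstReturnPath k i w}

/-- The generating function `S(z) = ∑_{i ≥ 1} s_i z ^ i` of the first-return numbers. -/
def firstReturnSeries (k : ℕ) (z : ℝ) : ℝ :=
  ∑' i : ℕ, (firstReturnCount k (i + 1) : ℝ) * z ^ (i + 1)

/-- `λ = S(p ^ (k - 1) q) / q` with `q = 1 - p`. -/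
def returnProb (k : ℕ) (p : ℝ) : ℝ :=
  1 / (1 - p) * firstReturnSeries k (p ^ (k - 1) * (1 - p))

/-- `R* = (k - 1) ^ (k - 1) / k ^ k * 1 / (p ^ (k - 1) q)` with `q = 1 - p`. -/
def critRadius (k : ℕ) (p : ℝ) : ℝ :=
  ((k : ℝ) - 1) ^ (k - 1) / (k : ℝ) ^ k * (1 / (p ^ (k - 1) * (1 - p)))

end

/-!
Let `m = k - 1`. At all times one box holds the minimum `y`, and the other boxes differ among
themselves by at most one, so the contents are described by `y` and the excess `d` of the total
over `k y` (`DescribedBy`). A big-chooser lowers `d` by one, a little-chooser raises `d` by `m` and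
lowers `y` by one, and at `d = 0` everybody acts as a little-chooser. The residue is the value of
`d` when `y` reaches `0` (`residue_eq`), whatever the tie-breaking rules.

Off `d = 0` the mean gain of `d` per step `+m` is `k - 1 / q`, and each visit to `d = 0` adds
`p / q` to it. Hence `M_n = n (k - 1 / q) + ∑ j < n, v_j`, where `v_j` is `p / q` times the
probability that the walk is at `0` after `j` steps `+m` (`expectedResidue_eq`). The weights are
`v_j = ∑ i ≥ 1, P(j, i)` (`visitWeight`), where `P(j, i)` is the probability that the unforced walk
passes from `i` to `0` with `j` steps `+m`. This gives two handles on `v_j`.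

* Generating functions. `∑ n, P(n, i) z ^ n = h ^ i` with `h = p + q z h ^ k`, so
  `∑ v_n z ^ n = h / (1 - h)` (`hasSum_visitWeight`); moreover `λ = h(1) ^ m` (`returnProb_eq`).
* Closed forms. The Raney numbers give `n P(n, i) = i ℙ(N = m n + i)` for a negative binomial `N`,
  so `n v_n = 𝔼 (N - m n)⁺` (`succ_mul_visitWeight`), a form of Spitzer's identity. Chernoff's
  bound for `N` has exactly the rate `1 / R*` (`one_div_critRadius`).

If `q > 1 / k`, the `v_n` decay at that rate and their sum is `h(1) / (1 - h(1))`, which is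
`(p / q) / (1 - λ)`. If `q < 1 / k`, the gains `k - 1 / q + v_n` are lower tail expectations and
decay at the same rate; their sum is the limit as `z → 1` of `(k - 1 / q) / (1 - z) + h / (1 - h)`,
found with `h = 1 - δ` as parameter (Abel's theorem, `hasSum_gain_of_subcritical`).

If `q = 1 / k`, the tail expectation telescopes to `v_n = m C(k n, n) p ^ (m n) q ^ n`
(`visitWeight_of_critical`). Stirling's formula compares it, with error `O(n ^ (-3 / 2))`, with
`√(k m / 2)` times the same sequence for `k = 2`, which is `C(2 n, n) / 4 ^ n`, has partial sums
`2 n C(2 n, n) / 4 ^ n` and generating function `1 / √(1 - z)`. The sum of the differences is the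
constant term `(k - 2) / 3`, again by Abel's theorem with the parameter `δ`
(`hasSum_visitWeight_sub`).
-/

/-! ### First passage of the distance to the diagonal -/

/-- The number of walks on `ℕ` with steps `-1` and `+m` that start at `i`, make exactly `n` steps
`+m`, and are at `0` at their end and at no earlier time. -/
def raneyNumber (m : ℕ) : ℕ → ℕ → ℕ
  | 0, _ => 1
  | _ + 1, 0 => 0
  | n + 1, i + 1 => raneyNumber m (n + 1) i + raneyNumber m n (i + 1 + m)
  termination_by n i => (n, i)

/-- The probability that the walk with steps `-1` (probability `p`) and `+m` (probability `q`)
started at `i` reaches `0`, and does so after exactly `n` steps `+m`. -/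
noncomputable def passageProb (m : ℕ) (p q : ℝ) (n i : ℕ) : ℝ :=
  raneyNumber m n i * p ^ (m * n + i) * q ^ n

@[simp] lemma raneyNumber_zero_left (m i : ℕ) : raneyNumber m 0 i = 1 := by
  rw [raneyNumber]

@[simp] lemma raneyNumber_succ_zero (m n : ℕ) : raneyNumber m (n + 1) 0 = 0 := by
  rw [raneyNumber]

lemma raneyNumber_succ_succ (m n i : ℕ) :
    raneyNumber m (n + 1) (i + 1) = raneyNumber m (n + 1) i + raneyNumber m n (i + 1 + m) := by
  rw [raneyNumber]

/-- The closed form `i / ((m + 1) n + i) * ((m + 1) n + i).choose n` of the Raney numbers, cleared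
of denominators. -/
lemma succ_mul_raneyNumber (m n : ℕ) : ∀ i : ℕ,
    (n + 1) * raneyNumber m (n + 1) (i + 1) = (i + 1) * ((m + 1) * (n + 1) + i).choose n := by
  induction n with
  | zero =>
    intro i
    induction i with
    | zero => simp [raneyNumber_succ_succ]
    | succ i ih =>
      rw [raneyNumber_succ_succ]
      simp at ih ⊢
      rw [ih]
  | succ n ihn =>
    intro i
    -- Pascal's rule and the ratio of neighbouring binomials reduce the recursion to an identity.
    have key : ∀ j : ℕ, (n + 1 + 1) * raneyNumber m (n + 1 + 1) j
          = j * ((m + 1) * (n + 1 + 1) + j - 1).choose (n + 1) →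
        (n + 1 + 1) * raneyNumber m (n + 1 + 1) (j + 1)
          = (j + 1) * ((m + 1) * (n + 1 + 1) + j).choose (n + 1) := by
      intro j hj
      obtain ⟨N, hN⟩ : ∃ N, N = (m + 1) * (n + 1) + (j + m) := ⟨_, rfl⟩
      have h1 : (m + 1) * (n + 1 + 1) + j - 1 = N := by rw [hN]; ring_nf; omega
      have h2 : (m + 1) * (n + 1 + 1) + j = N + 1 := by rw [hN]; ring
      have hA := ihn (j + m)
      have hch := Nat.choose_succ_right_eq N n
      have hNn : N - n = m * (n + 1) + 1 + (j + m) := by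
        rw [hN]; ring_nf; omega
      rw [hNn] at hch
      rw [h1] at hj
      rw [← hN] at hA
      rw [raneyNumber_succ_succ, h2, Nat.choose_succ_succ, show j + 1 + m = j + m + 1 by ring]
      have : (n + 1) * ((n + 1 + 1) * (raneyNumber m (n + 1 + 1) j
          + raneyNumber m (n + 1) (j + m + 1)))
          = (n + 1) * ((j + 1) * (N.choose n + N.choose (n + 1))) := by
        zify at *
        linear_combination (n + 1 : ℤ) * hj + (n + 2 : ℤ) * hA - hch
      exact Nat.eq_of_mul_eq_mul_left (Nat.succ_pos n) this
    induction i with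
    | zero => exact key 0 (by simp)
    | succ i ih => exact key (i + 1) ih

section

variable {m : ℕ} {p q : ℝ}

@[simp] lemma passageProb_zero_left (i : ℕ) : passageProb m p q 0 i = p ^ i := by
  simp [passageProb]

@[simp] lemma passageProb_succ_zero (n : ℕ) : passageProb m p q (n + 1) 0 = 0 := by
  simp [passageProb]

/-- Conditioning on the first step. -/
lemma passageProb_succ_succ (n i : ℕ) :
    passageProb m p q (n + 1) (i + 1)
      = p * passageProb m p q (n + 1) i + q * passageProb m p q n (i + 1 + m) := by
  simp only [passageProb, raneyNumber_succ_succ]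
  push_cast
  ring

lemma passageProb_nonneg (hp : 0 ≤ p) (hq : 0 ≤ q) (n i : ℕ) : 0 ≤ passageProb m p q n i := by
  unfold passageProb
  positivity

/-- To descend from `a + b` to `0` is to descend by `a` and then by `b`. -/
lemma sum_antidiagonal_passageProb (n : ℕ) : ∀ a b : ℕ,
    ∑ x ∈ Finset.HasAntidiagonal.antidiagonal n, passageProb m p q x.1 a * passageProb m p q x.2 b
      = passageProb m p q n (a + b) := by
  induction n with
  | zero => intro a b; simp [pow_add]
  | succ n ihn =>
    intro a b
    induction a with
    | zero =>
      rw [Finset.Nat.sum_antidiagonal_succ]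
      simp
    | succ a iha =>
      rw [show a + 1 + b = a + b + 1 by ring, passageProb_succ_succ,
        show a + b + 1 + m = (a + 1 + m) + b by ring, ← ihn, ← iha,
        Finset.Nat.sum_antidiagonal_succ, Finset.Nat.sum_antidiagonal_succ, mul_add,
        Finset.mul_sum, Finset.mul_sum, add_assoc, ← Finset.sum_add_distrib]
      congr 1
      · simp; ring
      · refine Finset.sum_congr rfl fun x _ => ?_
        rw [passageProb_succ_succ]
        ring

lemma sum_range_passageProb_le_one (hp : 0 ≤ p) (hq : 0 ≤ q) (hpq : p + q = 1) (N : ℕ) :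
    ∀ i : ℕ, ∑ n ∈ Finset.range N, passageProb m p q n i ≤ 1 := by
  induction N with
  | zero => intro i; simp
  | succ N ihN =>
    intro i
    induction i with
    | zero => rw [Finset.sum_range_succ']; simp
    | succ i ihi =>
      have h := ihN (i + 1 + m)
      rw [Finset.sum_range_succ'] at ihi ⊢
      simp only [passageProb_succ_succ, Finset.sum_add_distrib, ← Finset.mul_sum,
        passageProb_zero_left] at ihi ⊢
      rw [pow_succ]
      nlinarith

/-! ### Weighted numbers of visits to the diagonal -/

/-- The sum of the probabilities of passage from a level above `d` to `0` with `n` steps `+m`.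
It is `p / q` times the expected number of visits to `0` made after exactly `n` steps `+m` by the
walk that starts at `d` and is forced up by `m` whenever it is at `0`. -/
noncomputable def visitWeight (m : ℕ) (p q : ℝ) (n d : ℕ) : ℝ :=
  ∑' i : ℕ, passageProb m p q n (d + 1 + i)

lemma summable_passageProb (hp : 0 ≤ p) (hq : 0 ≤ q) (hpq : p + q = 1) (hq0 : q ≠ 0) (n : ℕ) :
    Summable fun i => passageProb m p q n i := by
  induction n with
  | zero =>
    simp only [passageProb_zero_left]
    exact summable_geometric_of_lt_one hp (by linarith [hq.lt_of_ne' hq0])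
  | succ n ih =>
    have hq' := hq.lt_of_ne' hq0
    have ih' : Summable fun i => passageProb m p q n (i + 1 + m) := by
      simpa only [add_assoc] using (summable_nat_add_iff (1 + m)).2 ih
    refine summable_of_sum_range_le (c := ∑' i, passageProb m p q n (i + 1 + m))
      (fun i => passageProb_nonneg hp hq _ _) fun N => ?_
    cases N with
    | zero => simpa using tsum_nonneg fun i => passageProb_nonneg hp hq n (i + 1 + m)
    | succ N =>
      have h1 := ih'.sum_le_tsum (Finset.range N) fun i _ => passageProb_nonneg hp hq n _
      have h2 : ∑ i ∈ Finset.range N, passageProb m p q (n + 1) i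
          ≤ ∑ i ∈ Finset.range (N + 1), passageProb m p q (n + 1) i :=
        Finset.sum_le_sum_of_subset_of_nonneg (by simp)
          fun i _ _ => passageProb_nonneg hp hq _ _
      have h3 : ∑ i ∈ Finset.range (N + 1), passageProb m p q (n + 1) i
          = p * ∑ i ∈ Finset.range N, passageProb m p q (n + 1) i
            + q * ∑ i ∈ Finset.range N, passageProb m p q n (i + 1 + m) := by
        rw [Finset.sum_range_succ', passageProb_succ_zero, add_zero, Finset.mul_sum,
          Finset.mul_sum, ← Finset.sum_add_distrib]
        exact Finset.sum_congr rfl fun i _ => passageProb_succ_succ n i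
      refine le_of_mul_le_mul_left ?_ hq'
      have h4 := mul_le_mul_of_nonneg_left h1 hq
      have h5 := mul_le_mul_of_nonneg_left h2 hp
      linear_combination h4 + h5 + h3
        + (∑ i ∈ Finset.range (N + 1), passageProb m p q (n + 1) i) * hpq

lemma summable_visitWeight_terms (hp : 0 ≤ p) (hq : 0 ≤ q) (hpq : p + q = 1) (hq0 : q ≠ 0)
    (n d : ℕ) : Summable fun i => passageProb m p q n (d + 1 + i) := by
  have := (summable_nat_add_iff (d + 1)).2 (summable_passageProb (m := m) hp hq hpq hq0 n)
  exact this.congr fun i => by rw [add_comm]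

lemma visitWeight_nonneg (hp : 0 ≤ p) (hq : 0 ≤ q) (n d : ℕ) : 0 ≤ visitWeight m p q n d :=
  tsum_nonneg fun _ => passageProb_nonneg hp hq _ _

lemma visitWeight_zero_left (hp : 0 ≤ p) (hq : 0 ≤ q) (hpq : p + q = 1) (hq0 : q ≠ 0) (d : ℕ) :
    visitWeight m p q 0 d = p ^ (d + 1) / q := by
  simp only [visitWeight, passageProb_zero_left, pow_add _ (d + 1)]
  rw [tsum_mul_left, tsum_geometric_of_lt_one hp (by linarith [hq.lt_of_ne' hq0]),
    ← hpq, add_sub_cancel_left, div_eq_mul_inv]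

lemma visitWeight_succ_succ (hp : 0 ≤ p) (hq : 0 ≤ q) (hpq : p + q = 1) (hq0 : q ≠ 0)
    (n d : ℕ) : visitWeight m p q (n + 1) (d + 1)
      = p * visitWeight m p q (n + 1) d + q * visitWeight m p q n (d + 1 + m) := by
  unfold visitWeight
  rw [← tsum_mul_left, ← tsum_mul_left, ← Summable.tsum_add
    ((summable_visitWeight_terms hp hq hpq hq0 _ _).mul_left _)
    ((summable_visitWeight_terms hp hq hpq hq0 _ _).mul_left _)]
  refine tsum_congr fun i => ?_
  rw [show d + 1 + 1 + i = (d + 1 + i) + 1 by ring, passageProb_succ_succ,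
    show d + 1 + i + 1 + m = d + 1 + m + 1 + i by ring]

/-- From the diagonal the walk is forced to level `m`. -/
lemma visitWeight_succ_zero (hp : 0 ≤ p) (hq : 0 ≤ q) (hpq : p + q = 1) (hq0 : q ≠ 0) (n : ℕ) :
    visitWeight m p q (n + 1) 0 = visitWeight m p q n m := by
  have hs := summable_passageProb (m := m) hp hq hpq hq0 (n + 1)
  have h0 : visitWeight m p q (n + 1) 0 = ∑' i, passageProb m p q (n + 1) i := by
    rw [hs.tsum_eq_zero_add, passageProb_succ_zero, zero_add]
    exact tsum_congr fun i => by rw [zero_add, add_comm 1 i]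
  have h1 : visitWeight m p q (n + 1) 0
      = p * ∑' i, passageProb m p q (n + 1) i + q * visitWeight m p q n m := by
    unfold visitWeight
    rw [← tsum_mul_left, ← tsum_mul_left, ← Summable.tsum_add (hs.mul_left _)
      ((summable_visitWeight_terms hp hq hpq hq0 _ _).mul_left _)]
    refine tsum_congr fun i => ?_
    rw [zero_add, add_comm 1 i, passageProb_succ_succ, show i + 1 + m = m + 1 + i by ring]
  rw [← h0] at h1
  have hp' : p = 1 - q := by linarith
  rw [hp'] at h1 ⊢
  have : q * (visitWeight m (1 - q) q (n + 1) 0 - visitWeight m (1 - q) q n m) = 0 := by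
    linarith
  rcases mul_eq_zero.1 this with h | h
  · exact absurd h hq0
  · linarith

end

/-! ### The distance process and the boxes -/

/-- One arrival, seen through the pair `(d, y)`: `y` is the smallest content of a box, and `d` is
the excess of the total content over `(m + 1) * y`. The pair stays put once `y = 0`. -/
def arrivalStep (m : ℕ) (b : Bool) : ℕ × ℕ → ℕ × ℕ
  | (d, 0) => (d, 0)
  | (0, y + 1) => (m, y)
  | (d + 1, y + 1) => if b = true then (d, y + 1) else (d + 1 + m, y)

/-- The pair `(d, y)` after `t` arrivals, started from `(0, n)`. -/
def arrivalState (m n : ℕ) (c : ℕ → Bool) : ℕ → ℕ × ℕ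
  | 0 => (0, n)
  | t + 1 => arrivalStep m (c t) (arrivalState m n c t)

/-- The contents `a` of the boxes are described by the pair `s = (d, y)`: some box holds the
minimum `y`, the others differ among themselves by at most one, and the total is
`(m + 1) * y + d`. -/
def DescribedBy {m : ℕ} (a : Fin (m + 1) → ℕ) (s : ℕ × ℕ) : Prop :=
  ∃ j₀, a j₀ = s.2 ∧ (∀ j, s.2 ≤ a j) ∧ (∀ i j, i ≠ j₀ → j ≠ j₀ → a i ≤ a j + 1) ∧
    ∑ j, a j = (m + 1) * s.2 + s.1

lemma sum_update_sub_one {m : ℕ} (a : Fin (m + 1) → ℕ) (j : Fin (m + 1)) (hj : a j ≠ 0) :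
    ∑ i, Function.update a j (a j - 1) i + 1 = ∑ i, a i := by
  rw [Finset.sum_update_of_mem (Finset.mem_univ j),
    ← Finset.add_sum_erase _ a (Finset.mem_univ j), Finset.sdiff_singleton_eq_erase]
  omega

/-- One arrival preserves the description of the boxes while all of them are nonempty. -/
lemma DescribedBy.step {m : ℕ} {big little : (Fin (m + 1) → ℕ) → Fin (m + 1)}
    (hbig : IsBigRule big) (hlittle : IsLittleRule little) {a : Fin (m + 1) → ℕ} {d y : ℕ}
    (h : DescribedBy a (d, y + 1)) (b : Bool) {j : Fin (m + 1)}
    (hj : j = if b = true then big a else little a) :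
    DescribedBy (Function.update a j (a j - 1)) (arrivalStep m b (d, y + 1)) := by
  obtain ⟨j₀, h0, hmin, hbal, hsum⟩ := h
  simp only at h0 hmin hsum
  have hjpos : a j ≠ 0 := by have := hmin j; omega
  have hupd := sum_update_sub_one a j hjpos
  rw [hsum] at hupd
  cases d with
  | zero =>
    -- On the diagonal all boxes are equal, so the two kinds of choosers act alike.
    have hall : ∀ i, a i = y + 1 := by
      intro i
      by_contra hi
      have hlt : ∑ _i : Fin (m + 1), (y + 1) < ∑ i, a i :=
        Finset.sum_lt_sum (fun i _ => hmin i)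
          ⟨i, Finset.mem_univ i, lt_of_le_of_ne (hmin i) (Ne.symm hi)⟩
      simp [hsum] at hlt
    refine ⟨j, by simp [arrivalStep, hall], fun i => ?_, fun i i' hi hi' => ?_, ?_⟩
    · by_cases hi : i = j
      · subst hi; simp [arrivalStep, hall]
      · simp [arrivalStep, hall, hi]
    · simp [hi, hi', hall]
    · simp only [arrivalStep]
      linarith
  | succ d =>
    cases b with
    | true =>
      simp only [if_true] at hj
      have hmax : ∀ i, a i ≤ a j := hj ▸ hbig a
      have hgt : y + 1 < a j := by
        by_contra hle
        have hle' : ∑ i, a i ≤ ∑ _i : Fin (m + 1), (y + 1) :=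
          Finset.sum_le_sum fun i _ => (hmax i).trans (not_lt.1 hle)
        simp [hsum] at hle'
      have hne : j₀ ≠ j := fun e => by rw [← e, h0] at hgt; omega
      simp only [arrivalStep, if_true]
      refine ⟨j₀, by simp [hne, h0], fun i => ?_, fun i i' hi hi' => ?_, ?_⟩
      · by_cases hi : i = j
        · subst hi; simp; omega
        · simp [hi, hmin]
      · have h1 := hmax i
        have h2 := hbal i i' hi hi'
        by_cases e : i = j <;> by_cases e' : i' = j <;> simp [e, e'] at * <;> omega
      · simp only
        linarith
    | false =>
      simp only [Bool.false_eq_true, if_false] at hj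
      have hlow : a j = y + 1 := le_antisymm (h0 ▸ hj ▸ hlittle a j₀) (hmin j)
      simp only [arrivalStep, Bool.false_eq_true, if_false]
      refine ⟨j, by simp [hlow], fun i => ?_, fun i i' hi hi' => ?_, ?_⟩
      · have := hmin i
        by_cases e : i = j <;> simp [e] <;> omega
      · simp only [Function.update_of_ne hi, Function.update_of_ne hi']
        have h1 := hmin i'
        by_cases e : i = j₀
        · rw [e, h0]; omega
        · by_cases e' : i' = j₀
          · by_cases ej : j = j₀
            · exact absurd (e'.trans ej.symm) hi'
            · have := hbal i j e ej
              rw [e', h0]; omega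
          · exact hbal i i' e e'
      · simp only
        linarith

lemma describedBy_boxes {m : ℕ} {big little : (Fin (m + 1) → ℕ) → Fin (m + 1)}
    (hbig : IsBigRule big) (hlittle : IsLittleRule little) (n : ℕ) (c : ℕ → Bool) :
    ∀ t, (∀ s < t, (arrivalState m n c s).2 ≠ 0) →
      DescribedBy (boxes big little n c t) (arrivalState m n c t) := by
  intro t
  induction t with
  | zero => intro _; exact ⟨0, by simp [boxes, arrivalState]⟩
  | succ t ih =>
    intro h
    have h1 := ih fun s hs => h s (by omega)
    have h2 := h t (by omega)
    rw [arrivalState]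
    generalize arrivalState m n c t = s at h1 h2 ⊢
    obtain ⟨d, y⟩ := s
    cases y with
    | zero => exact absurd rfl h2
    | succ y => exact h1.step hbig hlittle (c t) rfl

/-- As long as the process runs, each arrival removes one match. -/
lemma arrivalState_total (m n : ℕ) (c : ℕ → Bool) (t : ℕ) :
    (arrivalState m n c t).2 = 0 ∨
      (m + 1) * (arrivalState m n c t).2 + (arrivalState m n c t).1 + t = (m + 1) * n := by
  induction t with
  | zero => right; simp [arrivalState]
  | succ t ih =>
    rw [arrivalState]
    generalize arrivalState m n c t = s at ih ⊢
    obtain ⟨d, y⟩ := s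
    rcases y with _ | y
    · left; rfl
    · have ih' := ih.resolve_left (by simp)
      right
      simp only at ih'
      rcases d with _ | d
      · simp only [arrivalStep]; linarith
      · cases c t
        · simp only [arrivalStep, Bool.false_eq_true, if_false]; linarith
        · simp only [arrivalStep, if_true]; linarith

lemma arrivalState_snd_eq_zero (m n : ℕ) (c : ℕ → Bool) :
    (arrivalState m n c ((m + 1) * n)).2 = 0 := by
  rcases arrivalState_total m n c ((m + 1) * n) with h | h
  · exact h
  · have : (m + 1) * (arrivalState m n c ((m + 1) * n)).2 = 0 := by omega
    simpa using this

lemma arrivalState_add_of_snd_eq_zero {m n : ℕ} {c : ℕ → Bool} {t : ℕ}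
    (h : (arrivalState m n c t).2 = 0) (s : ℕ) :
    arrivalState m n c (t + s) = arrivalState m n c t := by
  induction s with
  | zero => rfl
  | succ s ih =>
    rw [← add_assoc, arrivalState, ih]
    generalize arrivalState m n c t = s at h ⊢
    obtain ⟨d, y⟩ := s
    simp only at h
    subst h
    rfl

/-- The residue is the final distance to the diagonal, whatever the tie-breaking rules. -/
lemma residue_eq {m : ℕ} {big little : (Fin (m + 1) → ℕ) → Fin (m + 1)}
    (hbig : IsBigRule big) (hlittle : IsLittleRule little) (n : ℕ) (c : ℕ → Bool) :
    residue big little n c = (arrivalState m n c ((m + 1) * n)).1 := by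
  classical
  have hex : ∃ t, (arrivalState m n c t).2 = 0 := ⟨_, arrivalState_snd_eq_zero m n c⟩
  set τ := Nat.find hex with hτ
  have h0 : (arrivalState m n c τ).2 = 0 := Nat.find_spec hex
  have hlt : ∀ s < τ, (arrivalState m n c s).2 ≠ 0 := fun s hs => Nat.find_min hex hs
  have hle : τ ≤ (m + 1) * n := Nat.find_le (arrivalState_snd_eq_zero m n c)
  obtain ⟨j₀, hj₀, hmin, hbal, hsum⟩ := describedBy_boxes hbig hlittle n c τ hlt
  have hempty : emptyTime big little n c = τ := by
    refine le_antisymm (Nat.sInf_le ⟨j₀, hj₀.trans h0⟩)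
      (le_csInf ⟨τ, j₀, hj₀.trans h0⟩ ?_)
    rintro t ⟨j, hj⟩
    by_contra hlt'
    push Not at hlt'
    obtain ⟨_, _, hmin', _, _⟩ := describedBy_boxes hbig hlittle n c t
      fun s hs => hlt s (hs.trans hlt')
    have := hmin' j
    exact hlt t hlt' (by omega)
  rw [residue, hempty, hsum, h0, ← Nat.add_sub_cancel' hle, arrivalState_add_of_snd_eq_zero h0]
  simp

/-! ### The expected residue -/

/-- The expected final distance of the process at distance `d` from the diagonal with minimum
`y`: every step `+m` gains `m + 1 - 1 / q` on average, and every visit to the diagonal, where the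
step `+m` is forced, gains another `p / q`. -/
noncomputable def expectedFinalDistance (m : ℕ) (p q : ℝ) (s : ℕ × ℕ) : ℝ :=
  s.1 + s.2 * ((m : ℝ) + 1 - 1 / q) + ∑ j ∈ Finset.range s.2, visitWeight m p q j s.1

/-- `expectedFinalDistance` is harmonic for the process. -/
lemma expectedFinalDistance_step {m : ℕ} {p q : ℝ} (hp : 0 ≤ p) (hq : 0 < q) (hpq : p + q = 1)
    (s : ℕ × ℕ) :
    p * expectedFinalDistance m p q (arrivalStep m true s)
        + q * expectedFinalDistance m p q (arrivalStep m false s)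
      = expectedFinalDistance m p q s := by
  obtain ⟨d, y⟩ := s
  have hqq : q * (1 / q) = 1 := by field_simp
  rcases y with _ | y
  · simp only [arrivalStep]
    linear_combination (expectedFinalDistance m p q (d, 0)) * hpq
  · rcases d with _ | d
    · simp only [arrivalStep, expectedFinalDistance]
      rw [Finset.sum_range_succ', visitWeight_zero_left hp hq.le hpq hq.ne']
      simp only [visitWeight_succ_zero hp hq.le hpq hq.ne']
      have hp' : p = 1 - q := by linarith
      have h3 : p ^ (0 + 1) / q = 1 / q - 1 := by rw [hp']; field_simp; ring
      rw [h3]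
      push_cast
      linear_combination ((m : ℝ) + y * (m + 1 - 1 / q)
        + ∑ j ∈ Finset.range y, visitWeight m p q j m) * hpq
    · simp only [arrivalStep, expectedFinalDistance, if_true, Bool.false_eq_true, if_false]
      rw [Finset.sum_range_succ', Finset.sum_range_succ' _ y,
        visitWeight_zero_left hp hq.le hpq hq.ne', visitWeight_zero_left hp hq.le hpq hq.ne']
      simp only [visitWeight_succ_succ hp hq.le hpq hq.ne', Finset.sum_add_distrib,
        ← Finset.mul_sum]
      push_cast
      linear_combination (d + (m + 1) + (y : ℝ) * (m + 1 - 1 / q) - (1 / q)) * hpq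
        + hqq

lemma arrivalState_congr {m n : ℕ} {c c' : ℕ → Bool} {t : ℕ} (h : ∀ s < t, c s = c' s) :
    arrivalState m n c t = arrivalState m n c' t := by
  induction t with
  | zero => rfl
  | succ t ih =>
    rw [arrivalState, arrivalState, ih fun s hs => h s (by omega), h t (by omega)]

lemma integrable_comp_of_finite {Ω α : Type*} [MeasurableSpace Ω] {μ : Measure Ω}
    [IsFiniteMeasure μ] [Finite α] [MeasurableSpace α] [DiscreteMeasurableSpace α] {g : Ω → α}
    (hg : Measurable g) (φ : α → ℝ) : Integrable (fun ω => φ (g ω)) μ := by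
  obtain ⟨C, hC⟩ := (Set.finite_range fun x => ‖φ x‖).bddAbove
  exact Integrable.of_bound ((Measurable.of_discrete.comp hg).aestronglyMeasurable) C
    (.of_forall fun ω => hC ⟨g ω, rfl⟩)

/-- The next arrival is independent of the present state, a function of the earlier arrivals. -/
lemma integral_arrivalState_succ {Ω : Type*} [MeasurableSpace Ω] {μ : Measure Ω}
    [IsProbabilityMeasure μ] {ξ : ℕ → Ω → Bool} (hmeas : ∀ t, Measurable (ξ t))
    (hindep : iIndepFun ξ μ) {p q : ℝ} (hlaw : ∀ t, μ.real {ω | ξ t ω = true} = p)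
    (hpq : p + q = 1) (m n t : ℕ) (V : ℕ × ℕ → ℝ) :
    ∫ ω, V (arrivalState m n (fun t => ξ t ω) (t + 1)) ∂μ
      = ∫ ω, (p * V (arrivalStep m true (arrivalState m n (fun t => ξ t ω) t))
          + q * V (arrivalStep m false (arrivalState m n (fun t => ξ t ω) t))) ∂μ := by
  classical
  let past : Ω → (Finset.range t → Bool) := fun ω i => ξ i ω
  have hpast : Measurable past := measurable_pi_lambda _ fun i => hmeas i
  let F : (Finset.range t → Bool) → ℕ × ℕ := fun g =>
    arrivalState m n (fun s => if h : s ∈ Finset.range t then g ⟨s, h⟩ else false) t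
  have hF : ∀ ω, arrivalState m n (fun t => ξ t ω) t = F (past ω) := fun ω =>
    arrivalState_congr fun s hs => by simp [past, hs]
  let A : (Finset.range t → Bool) → ℝ := fun g => V (arrivalStep m true (F g))
  let B : (Finset.range t → Bool) → ℝ := fun g => V (arrivalStep m false (F g))
  let X : Ω → ℝ := {ω | ξ t ω = true}.indicator fun _ => 1
  have hset : MeasurableSet {ω | ξ t ω = true} := hmeas t (measurableSet_singleton true)
  have hX : ∫ ω, X ω ∂μ = p := by
    rw [integral_indicator_const _ hset, hlaw, smul_eq_mul, mul_one]
  have hind : IndepFun X (fun ω => A (past ω) - B (past ω)) μ := by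
    have h := hindep.indepFun_finset {t} (Finset.range t) (by simp) hmeas
    let φ : (({t} : Finset ℕ) → Bool) → ℝ := fun g =>
      if g ⟨t, Finset.mem_singleton_self t⟩ = true then 1 else 0
    have h' := h.comp (φ := φ) (ψ := fun g => A g - B g) Measurable.of_discrete
      Measurable.of_discrete
    have e1 : (φ ∘ fun ω (i : ({t} : Finset ℕ)) => ξ i ω) = X := by
      funext ω
      simp [φ, X, Set.indicator_apply]
    rw [e1] at h'
    exact h'
  have hXint : Integrable X μ := (integrable_const (1 : ℝ)).indicator hset
  have hA := integrable_comp_of_finite (μ := μ) hpast A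
  have hB := integrable_comp_of_finite (μ := μ) hpast B
  have hprod : ∫ ω, X ω * (A (past ω) - B (past ω)) ∂μ
      = p * ∫ ω, (A (past ω) - B (past ω)) ∂μ := by
    rw [hind.integral_fun_mul_eq_mul_integral hXint.aestronglyMeasurable
      (hA.sub hB).aestronglyMeasurable, hX]
  have hint : Integrable (fun ω => X ω * (A (past ω) - B (past ω))) μ :=
    hind.integrable_mul hXint (hA.sub hB)
  have hL : ∀ ω, V (arrivalState m n (fun t => ξ t ω) (t + 1))
      = X ω * (A (past ω) - B (past ω)) + B (past ω) := by
    intro ω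
    rw [arrivalState, hF]
    by_cases h : ξ t ω = true
    · simp [X, h, A]
    · simp [X, h, B]
  simp_rw [hL, hF]
  rw [integral_add hint hB, hprod, integral_sub hA hB,
    integral_add (hA.const_mul p) (hB.const_mul q), integral_const_mul, integral_const_mul]
  linear_combination (-(∫ ω, B (past ω) ∂μ)) * hpq

/-- The expected residue through the weighted numbers of visits to the diagonal. -/
lemma expectedResidue_eq {Ω : Type*} [MeasurableSpace Ω] {μ : Measure Ω}
    [IsProbabilityMeasure μ] {ξ : ℕ → Ω → Bool} (hmeas : ∀ t, Measurable (ξ t))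
    (hindep : iIndepFun ξ μ) {p q : ℝ} (hlaw : ∀ t, μ.real {ω | ξ t ω = true} = p)
    (hp : 0 ≤ p) (hq : 0 < q) (hpq : p + q = 1) {m : ℕ}
    {big little : (Fin (m + 1) → ℕ) → Fin (m + 1)}
    (hbig : IsBigRule big) (hlittle : IsLittleRule little) (n : ℕ) :
    expectedResidue μ ξ big little n
      = n * ((m : ℝ) + 1 - 1 / q) + ∑ j ∈ Finset.range n, visitWeight m p q j 0 := by
  have hconst : ∀ t, ∫ ω, expectedFinalDistance m p q (arrivalState m n (fun t => ξ t ω) t) ∂μ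
      = expectedFinalDistance m p q (0, n) := by
    intro t
    induction t with
    | zero => simp [arrivalState]
    | succ t ih =>
      rw [integral_arrivalState_succ hmeas hindep hlaw hpq]
      simp_rw [expectedFinalDistance_step hp hq hpq]
      exact ih
  have h := hconst ((m + 1) * n)
  rw [expectedResidue]
  simp_rw [residue_eq hbig hlittle]
  simp only [expectedFinalDistance, arrivalState_snd_eq_zero] at h
  simpa using h

/-! ### Generating functions -/

/-- The generating function of the passage probabilities from `i` to `0`, the exponent counting
the steps `+m`. -/
noncomputable def passageSeries (m : ℕ) (p q z : ℝ) (i : ℕ) : ℝ :=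
  ∑' n : ℕ, passageProb m p q n i * z ^ n

section

variable {m : ℕ} {p q z : ℝ}

lemma summable_passageSeries (hp : 0 ≤ p) (hq : 0 ≤ q) (hpq : p + q = 1) (hz : 0 ≤ z)
    (hz1 : z ≤ 1) (i : ℕ) : Summable fun n => passageProb m p q n i * z ^ n := by
  have h1 : Summable fun n => passageProb m p q n i :=
    summable_of_sum_range_le (fun n => passageProb_nonneg hp hq n i)
      fun N => sum_range_passageProb_le_one hp hq hpq N i
  exact h1.of_nonneg_of_le (fun n => mul_nonneg (passageProb_nonneg hp hq n i) (by positivity))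
    fun n => mul_le_of_le_one_right (passageProb_nonneg hp hq n i) (pow_le_one₀ hz hz1)

lemma passageSeries_nonneg (hp : 0 ≤ p) (hq : 0 ≤ q) (hz : 0 ≤ z) (i : ℕ) :
    0 ≤ passageSeries m p q z i :=
  tsum_nonneg fun n => mul_nonneg (passageProb_nonneg hp hq n i) (by positivity)

lemma passageSeries_le_one (hp : 0 ≤ p) (hq : 0 ≤ q) (hpq : p + q = 1) (hz : 0 ≤ z)
    (hz1 : z ≤ 1) (i : ℕ) : passageSeries m p q z i ≤ 1 := by
  refine (summable_passageSeries hp hq hpq hz hz1 i).tsum_le_of_sum_range_le fun N => ?_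
  exact (Finset.sum_le_sum fun n _ => mul_le_of_le_one_right (passageProb_nonneg hp hq n i)
    (pow_le_one₀ hz hz1)).trans (sum_range_passageProb_le_one hp hq hpq N i)

lemma passageSeries_add (hp : 0 ≤ p) (hq : 0 ≤ q) (hpq : p + q = 1) (hz : 0 ≤ z)
    (hz1 : z ≤ 1) (a b : ℕ) :
    passageSeries m p q z (a + b) = passageSeries m p q z a * passageSeries m p q z b := by
  unfold passageSeries
  rw [tsum_mul_tsum_eq_tsum_sum_antidiagonal_of_summable_norm
    (summable_passageSeries hp hq hpq hz hz1 a).norm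
    (summable_passageSeries hp hq hpq hz hz1 b).norm]
  refine tsum_congr fun n => ?_
  rw [← sum_antidiagonal_passageProb, Finset.sum_mul]
  refine Finset.sum_congr rfl fun x hx => ?_
  rw [← Finset.HasAntidiagonal.mem_antidiagonal.1 hx, pow_add]
  ring

lemma passageSeries_zero_right : passageSeries m p q z 0 = 1 := by
  unfold passageSeries
  rw [tsum_eq_single 0]
  · simp
  · intro n hn
    obtain ⟨n, rfl⟩ := Nat.exists_eq_succ_of_ne_zero hn
    simp

lemma passageSeries_eq_pow (hp : 0 ≤ p) (hq : 0 ≤ q) (hpq : p + q = 1) (hz : 0 ≤ z)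
    (hz1 : z ≤ 1) (i : ℕ) : passageSeries m p q z i = passageSeries m p q z 1 ^ i := by
  induction i with
  | zero => simp [passageSeries_zero_right]
  | succ i ih => rw [passageSeries_add hp hq hpq hz hz1, ih, pow_succ]

/-- The algebraic equation satisfied by the generating function of a unit descent. -/
lemma passageSeries_one (hp : 0 ≤ p) (hq : 0 ≤ q) (hpq : p + q = 1) (hz : 0 ≤ z) (hz1 : z ≤ 1) :
    passageSeries m p q z 1 = p + q * z * passageSeries m p q z 1 ^ (m + 1) := by
  rw [← passageSeries_eq_pow hp hq hpq hz hz1]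
  conv_lhs => rw [passageSeries, (summable_passageSeries hp hq hpq hz hz1 1).tsum_eq_zero_add]
  rw [passageSeries, ← tsum_mul_left]
  congr 1
  · simp
  · refine tsum_congr fun n => ?_
    rw [show (1 : ℕ) = 0 + 1 from rfl, passageProb_succ_succ, passageProb_succ_zero,
      show 0 + 1 + m = m + 1 by ring]
    ring

/-- Below `1`, the equation of `passageSeries_one` has at most one root: a convex function
vanishes at most once before a point where it is negative. -/
lemma eq_of_passage_equation {x y : ℝ} (hq : 0 < q) (hpq : p + q = 1) (hz : 0 ≤ z) (hz1 : z < 1)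
    (hx0 : 0 ≤ x) (hx1 : x < 1) (hy0 : 0 ≤ y) (hy1 : y < 1)
    (hx : x = p + q * z * x ^ (m + 1)) (hy : y = p + q * z * y ^ (m + 1)) : x = y := by
  have key : ∀ x y : ℝ, 0 ≤ x → x < 1 → x < y → y < 1 → x = p + q * z * x ^ (m + 1) →
      y = p + q * z * y ^ (m + 1) → False := by
    intro x y hx0 hx1 hxy hy1 hx hy
    have h1x : 0 < 1 - x := by linarith
    obtain ⟨s, hs⟩ : ∃ s, s = (y - x) / (1 - x) := ⟨_, rfl⟩
    have hs0 : 0 < s := hs ▸ div_pos (by linarith) h1x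
    have hs1 : s ≤ 1 := by rw [hs, div_le_one h1x]; linarith
    have hsy : y = (1 - s) * x + s := by rw [hs]; field_simp; ring
    have hconv : y ^ (m + 1) ≤ (1 - s) * x ^ (m + 1) + s := by
      have h := (convexOn_pow (𝕜 := ℝ) (m + 1)).2 (Set.mem_Ici.2 hx0)
        (Set.mem_Ici.2 zero_le_one) (sub_nonneg.2 hs1) hs0.le (by ring)
      simpa [← hsy] using h
    have h2 : y ≤ p + q * z * ((1 - s) * x ^ (m + 1) + s) := by
      nth_rewrite 1 [hy]
      gcongr
    have h3 : p + q * z * ((1 - s) * x ^ (m + 1) + s) = (1 - s) * x + s * (p + q * z) := by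
      linear_combination (1 - s) * (-hx)
    have h4 : s * (p + q * z) < s := by
      have : q * z < q := by nlinarith
      nlinarith
    linarith
  rcases lt_trichotomy x y with h | h | h
  · exact (key x y hx0 hx1 h hy1 hx hy).elim
  · exact h
  · exact (key y x hy0 hy1 h hx1 hy hx).elim

lemma passageSeries_one_lt_one (hp : 0 ≤ p) (hq : 0 < q) (hpq : p + q = 1) (hz : 0 ≤ z)
    (hz1 : z < 1) : passageSeries m p q z 1 < 1 := by
  have h0 := passageSeries_nonneg (m := m) hp hq.le hz 1
  have h1 := passageSeries_le_one (m := m) hp hq.le hpq hz hz1.le 1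
  have h2 : passageSeries m p q z 1 ^ (m + 1) ≤ 1 := pow_le_one₀ h0 h1
  have h3 : q * z < q := by nlinarith
  have h4 : q * z * passageSeries m p q z 1 ^ (m + 1) ≤ q * z :=
    mul_le_of_le_one_right (by positivity) h2
  rw [passageSeries_one hp hq.le hpq hz hz1.le]
  linarith

lemma summable_visit_terms_iff (hp : 0 ≤ p) (hq : 0 < q) (hpq : p + q = 1) (hz : 0 ≤ z) :
    (Summable fun n => visitWeight m p q n 0 * z ^ n) ↔
      Summable fun x : ℕ × ℕ => passageProb m p q x.1 (0 + 1 + x.2) * z ^ x.1 := by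
  rw [summable_prod_of_nonneg fun x => mul_nonneg (passageProb_nonneg hp hq.le _ _)
    (by positivity)]
  simp only [tsum_mul_right, visitWeight]
  exact ⟨fun h => ⟨fun n => (summable_visitWeight_terms hp hq.le hpq hq.ne' n 0).mul_right _, h⟩,
    fun h => h.2⟩

lemma summable_visit_terms_iff_lt_one (hp : 0 ≤ p) (hq : 0 < q) (hpq : p + q = 1) (hz : 0 ≤ z)
    (hz1 : z ≤ 1) :
    (Summable fun x : ℕ × ℕ => passageProb m p q x.1 (0 + 1 + x.2) * z ^ x.1) ↔
      passageSeries m p q z 1 < 1 := by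
  have h0 := passageSeries_nonneg (m := m) hp hq.le hz 1
  have hprod := summable_prod_of_nonneg
    (f := fun x : ℕ × ℕ => passageProb m p q x.2 (0 + 1 + x.1) * z ^ x.2)
    fun x => mul_nonneg (passageProb_nonneg hp hq.le _ _) (pow_nonneg hz _)
  rw [← (Equiv.prodComm ℕ ℕ).summable_iff]
  refine hprod.trans ?_
  have e : ∀ i, ∑' n, passageProb m p q n (0 + 1 + i) * z ^ n
      = passageSeries m p q z 1 * passageSeries m p q z 1 ^ i := fun i => by
    rw [← pow_succ', ← passageSeries_eq_pow hp hq.le hpq hz hz1, zero_add, add_comm 1 i]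
    rfl
  simp only [e]
  constructor
  · rintro ⟨-, h⟩
    by_contra hlt
    have h1 : passageSeries m p q z 1 = 1 :=
      le_antisymm (passageSeries_le_one hp hq.le hpq hz hz1 1) (not_lt.1 hlt)
    simp [h1, summable_const_iff] at h
  · exact fun h => ⟨fun i => summable_passageSeries hp hq.le hpq hz hz1 _,
      (summable_geometric_of_lt_one h0 h).mul_left _⟩

/-- The generating function of the weighted visits is `h / (1 - h)`, where `h` is that of a unit
descent: sum the passages from every positive level. -/
lemma hasSum_visitWeight (hp : 0 ≤ p) (hq : 0 < q) (hpq : p + q = 1) (hz : 0 ≤ z)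
    (hz1 : z ≤ 1) (hlt : passageSeries m p q z 1 < 1) :
    HasSum (fun n => visitWeight m p q n 0 * z ^ n)
      (passageSeries m p q z 1 / (1 - passageSeries m p q z 1)) := by
  have h0 := passageSeries_nonneg (m := m) hp hq.le hz 1
  have hs := (summable_visit_terms_iff_lt_one (m := m) hp hq hpq hz hz1).2 hlt
  have h1 := hs.hasSum.prod_fiberwise
    fun n => ((summable_visitWeight_terms hp hq.le hpq hq.ne' n 0).mul_right (z ^ n)).hasSum
  have h2 := ((Equiv.prodComm ℕ ℕ).hasSum_iff.2 hs.hasSum).prod_fiberwise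
    fun i => (summable_passageSeries hp hq.le hpq hz hz1 (0 + 1 + i)).hasSum
  have h3 := (hasSum_geometric_of_lt_one h0 hlt).mul_left (passageSeries m p q z 1)
  have e : ∀ i, ∑' n, passageProb m p q n (0 + 1 + i) * z ^ n
      = passageSeries m p q z 1 * passageSeries m p q z 1 ^ i := fun i => by
    rw [← pow_succ', ← passageSeries_eq_pow hp hq.le hpq hz hz1, zero_add, add_comm 1 i]
    rfl
  simp only [e] at h2
  simp only [tsum_mul_right] at h1
  rw [div_eq_mul_inv, h3.unique h2]
  exact h1

end

/-! ### Negative binomial form of the visits -/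

/-- The probability of exactly `ν` failures (probability `p` each) before the `(n + 1)`-st
success (probability `q`). -/
noncomputable def negBinomial (p q : ℝ) (n ν : ℕ) : ℝ :=
  (ν + n).choose n * p ^ ν * q ^ (n + 1)

section

variable {m : ℕ} {p q θ : ℝ}

lemma negBinomial_nonneg (hp : 0 ≤ p) (hq : 0 ≤ q) (n ν : ℕ) : 0 ≤ negBinomial p q n ν := by
  unfold negBinomial
  positivity

lemma succ_mul_passageProb (n i : ℕ) :
    (n + 1) * passageProb m p q (n + 1) (i + 1)
      = (i + 1) * negBinomial p q n (m * (n + 1) + (i + 1)) := by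
  have h := succ_mul_raneyNumber m n i
  have e : m * (n + 1) + (i + 1) + n = (m + 1) * (n + 1) + i := by ring
  rw [passageProb, negBinomial, e]
  have h' : ((n : ℝ) + 1) * raneyNumber m (n + 1) (i + 1)
      = (i + 1) * ((m + 1) * (n + 1) + i).choose n := by exact_mod_cast h
  linear_combination (p ^ (m * (n + 1) + (i + 1)) * q ^ (n + 1)) * h'

lemma hasSum_negBinomial_mul_pow (hp : 0 ≤ p) (hθ : 0 ≤ θ) (h : θ * p < 1) (n : ℕ) :
    HasSum (fun ν => negBinomial p q n ν * θ ^ ν) ((q / (1 - θ * p)) ^ (n + 1)) := by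
  have hn : ‖θ * p‖ < 1 := by rwa [Real.norm_of_nonneg (by positivity)]
  have h1 := (hasSum_choose_mul_geometric_of_norm_lt_one n hn).mul_left (q ^ (n + 1))
  rw [div_pow, div_eq_mul_one_div]
  refine h1.congr_fun fun ν => ?_
  rw [negBinomial, mul_pow]
  ring

lemma hasSum_negBinomial (hp : 0 ≤ p) (hq : 0 < q) (hpq : p + q = 1) (n : ℕ) :
    HasSum (negBinomial p q n) 1 := by
  have h := hasSum_negBinomial_mul_pow (q := q) hp zero_le_one (by linarith) n
  have e : 1 - p = q := by linarith
  simpa [e, hq.ne'] using h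

lemma hasSum_mul_negBinomial (hp : 0 ≤ p) (hq : 0 < q) (hpq : p + q = 1) (n : ℕ) :
    HasSum (fun ν : ℕ => ν * negBinomial p q n ν) ((n + 1) * (p / q)) := by
  have h := (hasSum_negBinomial hp hq hpq (n + 1)).mul_left ((n + 1) * (p / q))
  rw [← hasSum_nat_add_iff' 1]
  simp only [Finset.range_one, Finset.sum_singleton, Nat.cast_zero, zero_mul, sub_zero]
  rw [mul_one] at h
  refine h.congr_fun fun ν => ?_
  have e : ((ν : ℝ) + 1) * (ν + 1 + n).choose n = (n + 1) * (ν + (n + 1)).choose (n + 1) := by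
    have h1 := Nat.choose_succ_right_eq (ν + 1 + n) n
    rw [Nat.add_sub_cancel] at h1
    rw [show ν + (n + 1) = ν + 1 + n by ring]
    have h2 : ((ν + 1 + n).choose (n + 1) : ℝ) * (n + 1) = (ν + 1 + n).choose n * (ν + 1) := by
      exact_mod_cast h1
    linarith
  simp only [negBinomial]
  push_cast
  field_simp
  linear_combination p ^ (ν + 1) * q ^ (n + 2) * e

lemma succ_mul_visitWeight (n : ℕ) :
    (n + 1) * visitWeight m p q (n + 1) 0
      = ∑' i : ℕ, ((i : ℝ) + 1) * negBinomial p q n (m * (n + 1) + (i + 1)) := by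
  rw [visitWeight, ← tsum_mul_left]
  refine tsum_congr fun i => ?_
  rw [← succ_mul_passageProb, zero_add, add_comm 1 i]

/-- Chernoff's bound for the upper tail. -/
lemma visitWeight_succ_le (hp : 0 ≤ p) (hq : 0 < q) (hθ : 1 < θ) (h : θ * p < 1)
    (n : ℕ) :
    visitWeight m p q (n + 1) 0 ≤ 1 / (θ - 1) * (q / ((1 - θ * p) * θ ^ m)) ^ (n + 1) := by
  have hθ0 : 0 < θ := by linarith
  have hS := hasSum_negBinomial_mul_pow (q := q) hp hθ0.le h n
  have hT := ((hasSum_nat_add_iff' (m * (n + 1) + 1)).2 hS).summable.mul_left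
    (1 / (θ - 1) * (1 / θ ^ (m * (n + 1))))
  have hle : ∀ i : ℕ, ((i : ℝ) + 1) * negBinomial p q n (m * (n + 1) + (i + 1))
      ≤ 1 / (θ - 1) * (1 / θ ^ (m * (n + 1)))
        * (negBinomial p q n (i + (m * (n + 1) + 1)) * θ ^ (i + (m * (n + 1) + 1))) := by
    intro i
    have hnb := negBinomial_nonneg hp hq.le n (m * (n + 1) + (i + 1))
    -- Bernoulli's inequality turns the linear factor into a power of `θ`.
    have hb : ((i : ℝ) + 1) ≤ 1 / (θ - 1) * θ ^ (i + 1) := by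
      have := one_add_mul_sub_le_pow (a := θ) (by linarith) (i + 1)
      rw [one_div, inv_mul_eq_div, le_div_iff₀ (by linarith)]
      push_cast at this
      linarith
    rw [show i + (m * (n + 1) + 1) = m * (n + 1) + (i + 1) by ring, pow_add θ]
    calc _ ≤ 1 / (θ - 1) * θ ^ (i + 1) * negBinomial p q n (m * (n + 1) + (i + 1)) := by gcongr
      _ = _ := by field_simp
  have hsum : ∑' i : ℕ, ((i : ℝ) + 1) * negBinomial p q n (m * (n + 1) + (i + 1))
      ≤ 1 / (θ - 1) * (1 / θ ^ (m * (n + 1))) * (q / (1 - θ * p)) ^ (n + 1) := by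
    refine ((hT.of_nonneg_of_le (fun i => mul_nonneg (by positivity)
      (negBinomial_nonneg hp hq.le n _)) hle).tsum_le_tsum hle hT).trans ?_
    rw [tsum_mul_left]
    have h1 : 0 < θ - 1 := by linarith
    gcongr
    rw [((hasSum_nat_add_iff' (m * (n + 1) + 1)).2 hS).tsum_eq]
    exact sub_le_self _ (Finset.sum_nonneg fun i _ =>
      mul_nonneg (negBinomial_nonneg hp hq.le n _) (by positivity))
  rw [← succ_mul_visitWeight] at hsum
  have hv := visitWeight_nonneg (m := m) hp hq.le (n + 1) 0
  calc visitWeight m p q (n + 1) 0 ≤ (n + 1) * visitWeight m p q (n + 1) 0 := by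
        have : (0 : ℝ) ≤ n * visitWeight m p q (n + 1) 0 := by positivity
        linarith
    _ ≤ _ := hsum
    _ = _ := by
      have : 0 < 1 - θ * p := by linarith
      rw [pow_mul θ, div_pow, div_pow, mul_pow]
      field_simp

/-- Spitzer's identity for the distance to the diagonal, with the sign that suits `q < 1 / k`:
the mean gain `m - p / q + visitWeight` is the lower tail expectation of a negative binomial
variable, over `n + 1`. -/
lemma succ_mul_add_visitWeight (hp : 0 ≤ p) (hq : 0 < q) (hpq : p + q = 1) (n : ℕ) :
    (n + 1) * (m - p / q + visitWeight m p q (n + 1) 0)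
      = ∑ ν ∈ Finset.range (m * (n + 1) + 1),
          ((m : ℝ) * (n + 1) - ν) * negBinomial p q n ν := by
  have h := (hasSum_mul_negBinomial hp hq hpq n).sub
    ((hasSum_negBinomial hp hq hpq n).mul_left ((m : ℝ) * (n + 1)))
  have h' := ((hasSum_nat_add_iff' (m * (n + 1) + 1)).2 h).tsum_eq
  have e : ∑' i : ℕ, ((i : ℝ) + 1) * negBinomial p q n (m * (n + 1) + (i + 1))
      = (n + 1) * (p / q) - (m : ℝ) * (n + 1) * 1
        - ∑ ν ∈ Finset.range (m * (n + 1) + 1), ((ν : ℝ) * negBinomial p q n ν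
          - (m : ℝ) * (n + 1) * negBinomial p q n ν) := by
    rw [← h']
    refine tsum_congr fun i => ?_
    rw [show i + (m * (n + 1) + 1) = m * (n + 1) + (i + 1) by ring]
    push_cast
    ring
  have e2 : ∑ ν ∈ Finset.range (m * (n + 1) + 1), ((ν : ℝ) * negBinomial p q n ν
          - (m : ℝ) * (n + 1) * negBinomial p q n ν)
      = -∑ ν ∈ Finset.range (m * (n + 1) + 1),
          ((m : ℝ) * (n + 1) - ν) * negBinomial p q n ν := by
    rw [← Finset.sum_neg_distrib]
    exact Finset.sum_congr rfl fun ν _ => by ring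
  rw [mul_add, succ_mul_visitWeight, e, e2]
  ring

lemma add_visitWeight_nonneg (hp : 0 ≤ p) (hq : 0 < q) (hpq : p + q = 1) (n : ℕ) :
    0 ≤ m - p / q + visitWeight m p q (n + 1) 0 := by
  refine nonneg_of_mul_nonneg_right ?_ (show (0 : ℝ) < n + 1 by positivity)
  rw [succ_mul_add_visitWeight hp hq hpq]
  refine Finset.sum_nonneg fun ν hν => mul_nonneg ?_ (negBinomial_nonneg hp hq.le n ν)
  have : (ν : ℝ) ≤ m * (n + 1) := by exact_mod_cast Nat.lt_succ_iff.1 (Finset.mem_range.1 hν)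
  linarith

/-- Chernoff's bound for the lower tail. -/
lemma add_visitWeight_le (hp : 0 ≤ p) (hq : 0 < q) (hpq : p + q = 1) (hθ : 0 < θ) (hθ1 : θ ≤ 1)
    (n : ℕ) :
    m - p / q + visitWeight m p q (n + 1) 0
      ≤ m * (q / ((1 - θ * p) * θ ^ m)) ^ (n + 1) := by
  have h1 : θ * p < 1 := lt_of_le_of_lt (mul_le_of_le_one_left hp hθ1) (by linarith)
  have hS := hasSum_negBinomial_mul_pow (q := q) hp hθ.le h1 n
  refine le_of_mul_le_mul_left ?_ (show (0 : ℝ) < n + 1 by positivity)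
  rw [succ_mul_add_visitWeight hp hq hpq]
  calc _ ≤ ∑ ν ∈ Finset.range (m * (n + 1) + 1),
        (m * (n + 1)) * (1 / θ ^ (m * (n + 1))) * (negBinomial p q n ν * θ ^ ν) := by
        refine Finset.sum_le_sum fun ν hν => ?_
        have hν' : ν ≤ m * (n + 1) := Nat.lt_succ_iff.1 (Finset.mem_range.1 hν)
        have hnb := negBinomial_nonneg hp hq.le n ν
        have hr : 1 ≤ 1 / θ ^ (m * (n + 1)) * θ ^ ν := by
          rw [one_div, inv_mul_eq_div, one_le_div (by positivity)]
          exact pow_le_pow_of_le_one hθ.le hθ1 hν'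
        calc ((m : ℝ) * (n + 1) - ν) * negBinomial p q n ν
            ≤ (m * (n + 1)) * negBinomial p q n ν := by
              gcongr
              linarith [(Nat.cast_nonneg ν : (0 : ℝ) ≤ ν)]
          _ ≤ (m * (n + 1)) * negBinomial p q n ν * (1 / θ ^ (m * (n + 1)) * θ ^ ν) :=
              le_mul_of_one_le_right (by positivity) hr
          _ = _ := by ring
    _ = (m * (n + 1)) * (1 / θ ^ (m * (n + 1))) * ∑ ν ∈ Finset.range (m * (n + 1) + 1),
          negBinomial p q n ν * θ ^ ν := by rw [Finset.mul_sum]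
    _ ≤ (m * (n + 1)) * (1 / θ ^ (m * (n + 1))) * (q / (1 - θ * p)) ^ (n + 1) := by
        gcongr
        exact sum_le_hasSum _ (fun ν _ => mul_nonneg (negBinomial_nonneg hp hq.le n ν)
          (by positivity)) hS
    _ = _ := by
      have : 0 < 1 - θ * p := by linarith
      rw [pow_mul θ, div_pow, div_pow, mul_pow]
      field_simp

/-- In the critical case the tail expectation telescopes to a single binomial probability. -/
lemma visitWeight_of_critical (hp : 0 ≤ p) (hq : 0 < q) (hpq : p + q = 1) (hcrit : p = m * q)
    (n : ℕ) :
    visitWeight m p q n 0 = m * (((m + 1) * n).choose n * p ^ (m * n) * q ^ n) := by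
  rcases n with _ | n
  · rw [visitWeight_zero_left hp hq.le hpq hq.ne']
    simp only [hcrit]
    field_simp
    simp
  · set N := m * (n + 1) with hN
    let g : ℕ → ℝ := fun ν => ν * negBinomial p q n ν
    have hg : ∀ ν, g (ν + 1) = p * (ν + n + 1) * negBinomial p q n ν := by
      intro ν
      have h1 := Nat.add_one_mul_choose_eq (ν + n) n
      have h2 := Nat.choose_succ_right_eq (ν + n + 1) n
      rw [show ν + n + 1 - n = ν + 1 by omega] at h2
      have h3 : ((ν : ℝ) + 1) * (ν + n + 1).choose n = (ν + n + 1) * (ν + n).choose n := by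
        have := h1.trans h2
        push_cast [← @Nat.cast_inj ℝ] at this
        linarith
      simp only [g, negBinomial, show ν + 1 + n = ν + n + 1 by ring]
      push_cast
      linear_combination p ^ (ν + 1) * q ^ (n + 1) * h3
    have hdiff : ∀ ν : ℕ, g ν - g (ν + 1) = q * ((ν : ℝ) - N) * negBinomial p q n ν := by
      intro ν
      rw [hg]
      simp only [g, hN]
      push_cast
      have h1 : (1 : ℝ) - p - q = 0 := by linarith
      linear_combination (ν * negBinomial p q n ν) * h1
        - ((n + 1) * negBinomial p q n ν) * hcrit
    have hlim : Tendsto g atTop (nhds 0) :=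
      (hasSum_mul_negBinomial hp hq hpq n).summable.tendsto_atTop_zero
    have hsum : HasSum (fun i : ℕ => q * (((i : ℝ) + 1) * negBinomial p q n (N + (i + 1))))
        (g (N + 1)) := by
      rw [hasSum_iff_tendsto_nat_of_nonneg fun i => mul_nonneg hq.le (mul_nonneg (by positivity)
        (negBinomial_nonneg hp hq.le n _))]
      have hpart : ∀ K : ℕ, ∑ i ∈ Finset.range K,
          q * (((i : ℝ) + 1) * negBinomial p q n (N + (i + 1))) = g (N + 1) - g (K + (N + 1)) := by
        intro K
        induction K with
        | zero => simp
        | succ K ih =>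
          have := hdiff (K + (N + 1))
          rw [Finset.sum_range_succ, ih, show K + 1 + (N + 1) = K + (N + 1) + 1 by ring,
            show N + (K + 1) = K + (N + 1) by ring]
          push_cast at this
          linear_combination (-1 : ℝ) * this
      simp only [hpart]
      simpa using ((tendsto_add_atTop_iff_nat (N + 1)).2 hlim).const_sub (g (N + 1))
    have h1 := hsum.tsum_eq
    rw [tsum_mul_left, ← succ_mul_visitWeight, hg] at h1
    have h2 := Nat.add_one_mul_choose_eq (N + n) n
    have h3 : (m + 1) * (n + 1) = N + n + 1 := by rw [hN]; ring
    have h4 : ((N : ℝ) + n + 1) * (N + n).choose n = (N + n + 1).choose (n + 1) * (n + 1) := by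
      exact_mod_cast h2
    rw [h3]
    have h5 : q * (n + 1) * (visitWeight m p q (n + 1) 0
        - m * (((N + n + 1).choose (n + 1) : ℝ) * p ^ N * q ^ (n + 1))) = 0 := by
      simp only [negBinomial] at h1
      linear_combination h1 + p * p ^ N * q ^ (n + 1) * h4
        + (n + 1) * ((N + n + 1).choose (n + 1) : ℝ) * p ^ N * q ^ (n + 1) * hcrit
    have h6 : q * ((n : ℝ) + 1) ≠ 0 := by positivity
    have := (mul_eq_zero.1 h5).resolve_left h6
    linarith

end

/-! ### First returns to the diagonal -/

/-- The height after `t` steps of the walk started at `d` in which the letter `true` is a step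
`-1` and `false` a step `+m`. -/
def walkHeight (m : ℕ) {L : ℕ} (d : ℕ) (w : Fin L → Bool) (t : ℕ) : ℤ :=
  d - (Finset.univ.filter fun j : Fin L => j.val < t ∧ w j = true).card
    + m * (Finset.univ.filter fun j : Fin L => j.val < t ∧ w j = false).card

/-- The words that code walks from `d` which are at `0` at their end and positive before. -/
def passageWords (m L d : ℕ) : Set (Fin L → Bool) :=
  {w | walkHeight m d w L = 0 ∧ ∀ t < L, 0 < walkHeight m d w t}

@[simp] lemma walkHeight_zero (m : ℕ) {L : ℕ} (d : ℕ) (w : Fin L → Bool) :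
    walkHeight m d w 0 = d := by
  simp [walkHeight]

lemma walkHeight_cons_true (m : ℕ) {L : ℕ} (d : ℕ) (w : Fin L → Bool) (t : ℕ) :
    walkHeight m d (Fin.cons true w : Fin (L + 1) → Bool) (t + 1) = walkHeight m d w t - 1 := by
  simp only [walkHeight, Fin.card_filter_univ_succ]
  simp
  ring

lemma walkHeight_cons_false (m : ℕ) {L : ℕ} (d : ℕ) (w : Fin L → Bool) (t : ℕ) :
    walkHeight m d (Fin.cons false w : Fin (L + 1) → Bool) (t + 1) = walkHeight m d w t + m := by
  simp only [walkHeight, Fin.card_filter_univ_succ]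
  simp
  ring

lemma walkHeight_add (m : ℕ) {L : ℕ} (d e : ℕ) (w : Fin L → Bool) (t : ℕ) :
    walkHeight m (d + e) w t = walkHeight m d w t + e := by
  simp only [walkHeight]
  push_cast
  ring

lemma cons_true_mem_passageWords {m L d : ℕ} {w : Fin L → Bool} :
    (Fin.cons true w : Fin (L + 1) → Bool) ∈ passageWords m (L + 1) (d + 1)
      ↔ w ∈ passageWords m L d := by
  simp only [passageWords, Set.mem_ofPred_eq, walkHeight_cons_true, walkHeight_add m d 1,
    Nat.cast_one, sub_add_cancel]
  refine and_congr_right fun _ => ⟨fun h t ht => ?_, fun h t ht => ?_⟩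
  · simpa [walkHeight_cons_true] using h (t + 1) (by omega)
  · rcases t with _ | t
    · simp
    · simpa [walkHeight_cons_true] using h t (by omega)

lemma cons_false_mem_passageWords {m L d : ℕ} {w : Fin L → Bool} :
    (Fin.cons false w : Fin (L + 1) → Bool) ∈ passageWords m (L + 1) (d + 1)
      ↔ w ∈ passageWords m L (d + 1 + m) := by
  simp only [passageWords, Set.mem_ofPred_eq, walkHeight_cons_false, walkHeight_add m (d + 1) m]
  refine and_congr_right fun _ => ⟨fun h t ht => ?_, fun h t ht => ?_⟩
  · simpa [walkHeight_cons_false] using h (t + 1) (by omega)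
  · rcases t with _ | t
    · simp
    · simpa [walkHeight_cons_false] using h t (by omega)

lemma ncard_passageWords_succ (m L d : ℕ) :
    (passageWords m (L + 1) (d + 1)).ncard
      = (passageWords m L d).ncard + (passageWords m L (d + 1 + m)).ncard := by
  have hU : passageWords m (L + 1) (d + 1)
      = @Fin.cons L (fun _ => Bool) true '' passageWords m L d ∪
        @Fin.cons L (fun _ => Bool) false ''
          passageWords m L (d + 1 + m) := by
    ext w
    obtain ⟨b, w, rfl⟩ : ∃ b v, w = (Fin.cons b v : Fin (L + 1) → Bool) :=
      ⟨w 0, Fin.tail w, (Fin.cons_self_tail w).symm⟩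
    cases b
    · rw [cons_false_mem_passageWords]
      simp [Fin.cons_inj]
    · rw [cons_true_mem_passageWords]
      simp [Fin.cons_inj]
  have hdisj : Disjoint
      (@Fin.cons L (fun _ => Bool) true '' passageWords m L d)
      (@Fin.cons L (fun _ => Bool) false ''
        passageWords m L (d + 1 + m)) := by
    rw [Set.disjoint_left]
    rintro _ ⟨v, -, rfl⟩ ⟨v', -, h⟩
    simp [Fin.cons_inj] at h
  rw [hU, Set.ncard_union_eq hdisj,
    Set.ncard_image_of_injective _ (Fin.cons_right_injective (α := fun _ => Bool) true),
    Set.ncard_image_of_injective _ (Fin.cons_right_injective (α := fun _ => Bool) false)]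

lemma passageWords_eq_empty {m L d : ℕ} (h : L < d) : passageWords m L d = ∅ := by
  ext w
  simp only [passageWords, Set.mem_ofPred_eq, Set.mem_empty_iff_false, iff_false, not_and]
  intro h0
  exfalso
  simp only [walkHeight] at h0
  have h1 := Finset.card_filter_le (Finset.univ : Finset (Fin L))
    fun j : Fin L => j.val < L ∧ w j = true
  simp only [Finset.card_univ, Fintype.card_fin] at h1
  have h2 : (0 : ℤ) ≤ m * (Finset.univ.filter fun j : Fin L => j.val < L ∧ w j = false).card := by
    positivity
  omega

/-- Passage words are counted by the Raney numbers: both satisfy the first step recursion. -/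
lemma ncard_passageWords (m n : ℕ) : ∀ d : ℕ,
    (passageWords m ((m + 1) * n + d) d).ncard = raneyNumber m n d := by
  induction n with
  | zero =>
    intro d
    rw [mul_zero, zero_add, raneyNumber_zero_left]
    induction d with
    | zero =>
      have : passageWords m 0 0 = {Fin.elim0} := by
        ext w
        simp [passageWords, Subsingleton.elim w Fin.elim0]
      rw [this, Set.ncard_singleton]
    | succ d ih =>
      rw [ncard_passageWords_succ, ih, passageWords_eq_empty (by omega), Set.ncard_empty]
  | succ n ihn =>
    intro d
    induction d with
    | zero =>
      rw [raneyNumber_succ_zero, Set.ncard_eq_zero]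
      ext w
      simp only [passageWords, Set.mem_ofPred_eq, Set.mem_empty_iff_false, iff_false, not_and]
      intro _ h
      simpa using h 0 (by positivity)
    | succ d ihd =>
      rw [← add_assoc, ncard_passageWords_succ, ihd, raneyNumber_succ_succ,
        show (m + 1) * (n + 1) + d = (m + 1) * n + (d + 1 + m) by ring, ihn]

lemma card_filter_true_add_card_filter_false {L : ℕ} (w : Fin L → Bool) :
    (Finset.univ.filter fun j : Fin L => j.val < L ∧ w j = true).card
      + (Finset.univ.filter fun j : Fin L => j.val < L ∧ w j = false).card = L := by
  have h := Finset.card_filter_add_card_filter_not (s := (Finset.univ : Finset (Fin L)))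
    (fun j => w j = true)
  simpa using h

/-- In terms of the height `x - (k - 1) y`, a first return path is a closed walk that is positive
at all intermediate times. -/
lemma isFirstReturnPath_iff {m i : ℕ} (w : Fin ((m + 1) * i) → Bool) :
    IsFirstReturnPath (m + 1) i w ↔ walkHeight m 0 w ((m + 1) * i) = 0 ∧
      ∀ t ∈ Finset.Ioo 0 ((m + 1) * i), 0 < walkHeight m 0 w t := by
  have hD : ∀ t, walkHeight m 0 w t
      = pathX (m + 1) i w t - m * pathY (m + 1) i w t := fun t => by
    simp only [walkHeight, pathX, pathY]
    push_cast
    ring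
  have hend : (pathX (m + 1) i w ((m + 1) * i) = 0 ∧ pathY (m + 1) i w ((m + 1) * i) = 0) ↔
      walkHeight m 0 w ((m + 1) * i) = 0 := by
    constructor
    · rintro ⟨h1, h2⟩
      rw [hD, h1, h2]
      ring
    · intro h
      have hc := card_filter_true_add_card_filter_false w
      simp only [walkHeight, pathX, pathY] at h ⊢
      generalize (Finset.univ.filter fun j : Fin ((m + 1) * i) =>
        j.val < (m + 1) * i ∧ w j = true).card = a at hc h ⊢
      generalize (Finset.univ.filter fun j : Fin ((m + 1) * i) =>
        j.val < (m + 1) * i ∧ w j = false).card = b at hc h ⊢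
      zify at hc
      push_cast at *
      have hb : ((m : ℤ) + 1) * (b - i) = 0 := by linear_combination hc + h
      have hb' : (b : ℤ) - i = 0 := (mul_eq_zero.1 hb).resolve_left (by positivity)
      constructor
      · linear_combination h - m * hb'
      · linear_combination -hb'
  unfold IsFirstReturnPath
  rw [← and_assoc, hend]
  refine and_congr_right fun _ => forall₂_congr fun t _ => ?_
  rw [hD]
  push_cast
  constructor <;> intro h <;> linarith

/-- The first step of a closed walk that is positive at all intermediate times leads to height
`m`; the rest is a first passage. -/
lemma closed_walk_iff {m L : ℕ} (hL : 1 ≤ L) (w : Fin (L + 1) → Bool) :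
    (walkHeight m 0 w (L + 1) = 0 ∧ ∀ t ∈ Finset.Ioo 0 (L + 1), 0 < walkHeight m 0 w t) ↔
      w ∈ @Fin.cons L (fun _ => Bool) false '' passageWords m L m := by
  obtain ⟨b, w, rfl⟩ : ∃ b v, w = (Fin.cons b v : Fin (L + 1) → Bool) :=
    ⟨w 0, Fin.tail w, (Fin.cons_self_tail w).symm⟩
  cases b
  · have e : ∀ t, walkHeight m 0 (Fin.cons false w : Fin (L + 1) → Bool) (t + 1)
        = walkHeight m m w t := fun t => by
      rw [walkHeight_cons_false, ← walkHeight_add, zero_add]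
    simp only [e, Set.mem_image, Fin.cons_inj, true_and, exists_eq_right, passageWords,
      Set.mem_ofPred_eq, Finset.mem_Ioo]
    refine and_congr_right fun _ => ⟨fun h t ht => ?_, fun h t ht => ?_⟩
    · exact e t ▸ h (t + 1) ⟨by omega, by omega⟩
    · obtain ⟨t, rfl⟩ := Nat.exists_eq_succ_of_ne_zero ht.1.ne'
      exact (e t).symm ▸ h t (by omega)
  · refine iff_of_false (fun h => ?_) ?_
    · have := h.2 (0 + 1) (by simp; omega)
      rw [walkHeight_cons_true] at this
      simp at this
    · simp [Fin.cons_inj]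

lemma firstReturnCount_succ {m : ℕ} (hm : 1 ≤ m) (i : ℕ) :
    firstReturnCount (m + 1) (i + 1) = raneyNumber m i m := by
  rw [firstReturnCount, ← ncard_passageWords, ← Set.ncard_image_of_injective _
    (Fin.cons_right_injective (α := fun _ => Bool) (n := (m + 1) * i + m) false)]
  congr 1
  ext w
  exact (isFirstReturnPath_iff w).trans (closed_walk_iff (le_add_left hm) w)

/-- The series `λ` is the value at `1` of the generating function of the first returns. -/
lemma returnProb_eq {m : ℕ} (hm : 1 ≤ m) {p q : ℝ} (hp : 0 ≤ p) (hq : 0 < q) (hpq : p + q = 1) :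
    returnProb (m + 1) p = passageSeries m p q 1 1 ^ m := by
  have hq' : 1 - p = q := by linarith
  rw [← passageSeries_eq_pow hp hq.le hpq zero_le_one le_rfl, returnProb, firstReturnSeries, hq',
    ← tsum_mul_left, passageSeries]
  refine tsum_congr fun i => ?_
  rw [firstReturnCount_succ hm, passageProb, Nat.add_sub_cancel, mul_pow, ← pow_mul, mul_add,
    mul_one, one_pow, pow_succ q]
  field_simp

/-! ### The exponential rate -/

section

variable {m : ℕ} {p q : ℝ}

/-- `1 / R*` is the best constant in Chernoff's bound. -/
lemma one_div_critRadius (hm : 1 ≤ m) (hp : 0 < p) (hpq : p + q = 1) :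
    1 / critRadius (m + 1) p
      = q / ((1 - m / ((m + 1) * p) * p) * (m / ((m + 1) * p)) ^ m) := by
  have hm0 : (0 : ℝ) < m := by exact_mod_cast hm
  have e : 1 - (m : ℝ) / ((m + 1) * p) * p = 1 / (m + 1) := by field_simp; ring
  rw [critRadius, e, show 1 - p = q by linarith, Nat.add_sub_cancel]
  push_cast
  rw [add_sub_cancel_right, div_pow, mul_pow, pow_succ]
  field_simp

lemma critRadius_pos (hm : 1 ≤ m) (hp : 0 < p) (hp1 : p < 1) : 0 < critRadius (m + 1) p := by
  have hm0 : (0 : ℝ) < m := by exact_mod_cast hm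
  have : 0 < 1 - p := by linarith
  rw [critRadius]
  push_cast
  rw [add_sub_cancel_right]
  positivity

/-- The strict inequality of arithmetic and geometric means for `(m + 1) q` and `m` copies of
`(m + 1) p / m`. -/
lemma one_div_critRadius_lt_one (hm : 1 ≤ m) (hp : 0 < p) (hq : 0 < q) (hpq : p + q = 1)
    (hne : (m + 1) * q ≠ 1) : 1 / critRadius (m + 1) p < 1 := by
  have hm0 : (0 : ℝ) < m := by exact_mod_cast hm
  have e : 1 / critRadius (m + 1) p = ((m + 1) * q) * ((m + 1) * p / m) ^ m := by
    rw [one_div_critRadius hm hp hpq,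
      show 1 - (m : ℝ) / ((m + 1) * p) * p = 1 / (m + 1) by field_simp; ring,
      div_pow, div_pow]
    field_simp
  have h1 : (m + 1) * q < Real.exp ((m + 1) * q - 1) := by
    have := Real.add_one_lt_exp (x := (m + 1) * q - 1) (sub_ne_zero.2 hne)
    linarith
  have h2 : (m + 1) * p / m ≤ Real.exp ((m + 1) * p / m - 1) := by
    have := Real.add_one_le_exp ((m + 1) * p / m - 1)
    linarith
  rw [e]
  calc ((m + 1) * q) * ((m + 1) * p / m) ^ m
      < Real.exp ((m + 1) * q - 1) * ((m + 1) * p / m) ^ m := by gcongr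
    _ ≤ Real.exp ((m + 1) * q - 1) * Real.exp ((m + 1) * p / m - 1) ^ m := by gcongr
    _ = Real.exp 0 := by
      rw [← Real.exp_nat_mul, ← Real.exp_add]
      congr 1
      field_simp
      linear_combination (m + 1 : ℝ) * hpq
    _ = 1 := Real.exp_zero

lemma isBigO_sum_range_sub_of_geometric {f : ℕ → ℝ} {C ρ S ε : ℝ} (hρ : 0 < ρ) (hρ1 : ρ < 1)
    (hf : ∀ n, |f (n + 1)| ≤ C * ρ ^ (n + 1)) (hS : HasSum f S) (hε : 0 < ε) :
    (fun n => ∑ j ∈ Finset.range n, f j - S) =O[atTop] fun n => (ρ + ε) ^ n := by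
  have hf' : ∀ n, ‖f n‖ ≤ max C |f 0| * ρ ^ n := by
    rintro (_ | n)
    · simp
    · exact (hf n).trans (by gcongr; exact le_max_left _ _)
  refine IsBigO.of_bound (max C |f 0| / (1 - ρ)) (.of_forall fun n => ?_)
  have hC : 0 ≤ max C |f 0| := (abs_nonneg _).trans (le_max_right _ _)
  have h1 : 0 < 1 - ρ := by linarith
  rw [Real.norm_of_nonneg (show 0 ≤ (ρ + ε) ^ n by positivity)]
  calc _ ≤ max C |f 0| * ρ ^ n / (1 - ρ) :=
        norm_sub_le_of_geometric_bound_of_hasSum hρ1 hf' hS n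
    _ = max C |f 0| / (1 - ρ) * ρ ^ n := by ring
    _ ≤ _ := by gcongr; linarith

/-! ### The case `q > 1 / k` -/

lemma passageSeries_one_pos (hp : 0 < p) (hq : 0 ≤ q) (hpq : p + q = 1) {z : ℝ} (hz : 0 ≤ z)
    (hz1 : z ≤ 1) : 0 < passageSeries m p q z 1 := by
  have h0 := passageSeries_nonneg (m := m) hp.le hq hz 1
  rw [passageSeries_one hp.le hq hpq hz hz1]
  positivity

/-- Chernoff's bound at the optimal base `m / ((m + 1) p)`, which exceeds `1` in this case. -/
lemma visit_chernoff (hm : 1 ≤ m) (hp : 0 < p) (hq : 0 < q) (hpq : p + q = 1)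
    (hlt : 1 < (m + 1) * q) (n : ℕ) :
    visitWeight m p q (n + 1) 0
      ≤ 1 / (m / ((m + 1) * p) - 1) * (1 / critRadius (m + 1) p) ^ (n + 1) := by
  have hm0 : (0 : ℝ) < m := by exact_mod_cast hm
  rw [one_div_critRadius hm hp hpq]
  refine visitWeight_succ_le hp.le hq ?_ ?_ n
  · rw [one_lt_div (by positivity)]
    nlinarith
  · rw [div_mul_eq_mul_div, div_lt_one (by positivity)]
    nlinarith

/-- The weights are summable, which forces `h(1) < 1`. -/
lemma passageSeries_one_one_lt_one (hm : 1 ≤ m) (hp : 0 < p) (hq : 0 < q) (hpq : p + q = 1)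
    (hlt : 1 < (m + 1) * q) : passageSeries m p q 1 1 < 1 := by
  rw [← summable_visit_terms_iff_lt_one hp.le hq hpq zero_le_one le_rfl,
    ← summable_visit_terms_iff hp.le hq hpq zero_le_one]
  simp only [one_pow, mul_one]
  rw [← summable_nat_add_iff 1]
  have hρ := (critRadius_pos hm hp (by linarith : p < 1)).le
  refine Summable.of_nonneg_of_le (fun n => visitWeight_nonneg hp.le hq.le _ _)
    (visit_chernoff hm hp hq hpq hlt) (Summable.mul_left _ ?_)
  exact (summable_nat_add_iff 1).2 (summable_geometric_of_lt_one (by positivity)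
    (one_div_critRadius_lt_one hm hp hq hpq hlt.ne'))

lemma returnProb_mem_Ioo (hm : 1 ≤ m) (hp : 0 < p) (hq : 0 < q) (hpq : p + q = 1)
    (hlt : 1 < (m + 1) * q) : returnProb (m + 1) p ∈ Set.Ioo (0 : ℝ) 1 := by
  rw [returnProb_eq hm hp.le hq hpq]
  have h0 := passageSeries_one_pos (m := m) hp hq.le hpq zero_le_one le_rfl
  exact ⟨by positivity,
    pow_lt_one₀ h0.le (passageSeries_one_one_lt_one hm hp hq hpq hlt) (by omega)⟩

/-- The sum `h / (1 - h)` of the weights equals `(p / q) / (1 - λ)` by the equation for `h`, and the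
tail is geometric. -/
lemma isBigO_visits_of_supercritical (hm : 1 ≤ m) (hp : 0 < p) (hq : 0 < q) (hpq : p + q = 1)
    (hlt : 1 < (m + 1) * q) {ε : ℝ} (hε : 0 < ε) :
    (fun n => ∑ j ∈ Finset.range n, visitWeight m p q j 0
        - p / q * (1 / (1 - returnProb (m + 1) p)))
      =O[atTop] fun n => (1 / critRadius (m + 1) p + ε) ^ n := by
  have h1 := passageSeries_one_one_lt_one hm hp hq hpq hlt
  have h0 := passageSeries_one_pos (m := m) hp hq.le hpq zero_le_one le_rfl
  have heq := passageSeries_one (m := m) hp.le hq.le hpq zero_le_one le_rfl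
  have hmem := returnProb_mem_Ioo hm hp hq hpq hlt
  have hS := hasSum_visitWeight (m := m) hp.le hq hpq zero_le_one le_rfl h1
  rw [returnProb_eq hm hp.le hq hpq] at hmem ⊢
  have e : p / q * (1 / (1 - passageSeries m p q 1 1 ^ m))
      = passageSeries m p q 1 1 / (1 - passageSeries m p q 1 1) := by
    have hne1 : 1 - passageSeries m p q 1 1 ≠ 0 := by linarith
    have hne2 : 1 - passageSeries m p q 1 1 ^ m ≠ 0 := by linarith [hmem.2]
    field_simp
    linear_combination (-1 : ℝ) * heq - passageSeries m p q 1 1 * hpq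
  rw [e]
  simp only [one_pow, mul_one] at hS
  have hρ := critRadius_pos hm hp (by linarith : p < 1)
  refine isBigO_sum_range_sub_of_geometric (C := 1 / (m / ((m + 1) * p) - 1)) (by positivity)
    (one_div_critRadius_lt_one hm hp hq hpq hlt.ne') (fun n => ?_) hS hε
  rw [abs_of_nonneg (visitWeight_nonneg hp.le hq.le _ _)]
  exact visit_chernoff hm hp hq hpq hlt n

/-! ### Expansion at the singularity -/

/-- Taylor's formula for `(1 - δ) ^ k` with a continuous remainder. -/
lemma exists_one_sub_pow_eq (k : ℕ) : ∃ R : ℝ → ℝ, Continuous R ∧ ∀ δ : ℝ,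
    (1 - δ) ^ k = 1 - k * δ + k * (k - 1) / 2 * δ ^ 2 - k * (k - 1) * (k - 2) / 6 * δ ^ 3
      + δ ^ 4 * R δ := by
  induction k with
  | zero => exact ⟨fun _ => 0, continuous_const, fun δ => by simp⟩
  | succ k ih =>
    obtain ⟨R, hR, h⟩ := ih
    refine ⟨fun δ => (1 - δ) * R δ + k * (k - 1) * (k - 2) / 6, by fun_prop, fun δ => ?_⟩
    rw [pow_succ, h]
    push_cast
    ring

/-- The value of `z` at which the generating function of a unit descent is `1 - δ`. -/
noncomputable def descentParam (m : ℕ) (q δ : ℝ) : ℝ :=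
  (1 - δ / q) / (1 - δ) ^ (m + 1)

lemma passageSeries_descentParam (hp : 0 ≤ p) (hq : 0 < q) (hpq : p + q = 1) {δ : ℝ} (hδ : 0 < δ)
    (hδ1 : δ < 1) (hz : 0 ≤ descentParam m q δ) (hz1 : descentParam m q δ < 1) :
    passageSeries m p q (descentParam m q δ) 1 = 1 - δ := by
  refine eq_of_passage_equation hq hpq hz hz1 (passageSeries_nonneg hp hq.le hz 1)
    (passageSeries_one_lt_one hp hq hpq hz hz1) (by linarith) (by linarith)
    (passageSeries_one hp hq.le hpq hz hz1.le) ?_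
  have : (1 - δ) ≠ 0 := by linarith
  rw [descentParam]
  field_simp
  linear_combination (-1 : ℝ) * hpq

/-- The expansion of `1 - z` at `δ = 0`. -/
lemma exists_one_sub_descentParam_eq (m : ℕ) (q : ℝ) : ∃ R : ℝ → ℝ, Continuous R ∧
    ∀ δ : ℝ, δ < 1 →
      (1 - δ) ^ (m + 1) = 1 - (m + 1) * δ + (m + 1) * m / 2 * δ ^ 2
        - (m + 1) * m * (m - 1) / 6 * δ ^ 3 + δ ^ 4 * R δ ∧
      1 - descentParam m q δ = δ * (1 / q - (m + 1) + (m + 1) * m / 2 * δ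
        - (m + 1) * m * (m - 1) / 6 * δ ^ 2 + δ ^ 3 * R δ) / (1 - δ) ^ (m + 1) := by
  obtain ⟨R, hR, h⟩ := exists_one_sub_pow_eq (m + 1)
  refine ⟨R, hR, fun δ hδ => ?_⟩
  have h1 : (1 - δ) ^ (m + 1) = 1 - (m + 1) * δ + (m + 1) * m / 2 * δ ^ 2
        - (m + 1) * m * (m - 1) / 6 * δ ^ 3 + δ ^ 4 * R δ := by
    rw [h]
    push_cast
    ring
  refine ⟨h1, ?_⟩
  have hne : (1 - δ) ^ (m + 1) ≠ 0 := pow_ne_zero _ (by linarith)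
  rw [descentParam, eq_div_iff hne, sub_mul, div_mul_cancel₀ _ hne, h1]
  ring

lemma tendsto_descentParam (hq : 0 < q) (hle : (m + 1) * q ≤ 1) (hm : 1 ≤ m) :
    Tendsto (descentParam m q) (nhdsWithin 0 (Set.Ioi 0)) (nhdsWithin 1 (Set.Iio 1)) := by
  obtain ⟨R, hR, h⟩ := exists_one_sub_descentParam_eq m q
  have hm0 : (0 : ℝ) < m := by exact_mod_cast hm
  rw [tendsto_nhdsWithin_iff]
  constructor
  · have hc : ContinuousAt (descentParam m q) 0 := by
      unfold descentParam
      refine ContinuousAt.div (by fun_prop) (by fun_prop) (by simp)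
    have h0 : descentParam m q 0 = 1 := by simp [descentParam]
    have := hc.tendsto
    rw [h0] at this
    exact this.mono_left nhdsWithin_le_nhds
  · have hα : 0 ≤ 1 / q - (m + 1) := by
      rw [sub_nonneg, le_div_iff₀ hq]
      exact hle
    have hpos : ∀ᶠ δ in nhds (0 : ℝ), 0 < (m + 1) * m / 2
        - (m + 1) * m * (m - 1) / 6 * δ + δ ^ 2 * R δ := by
      have hc : Continuous fun δ : ℝ => ((m : ℝ) + 1) * m / 2
        - (m + 1) * m * (m - 1) / 6 * δ + δ ^ 2 * R δ := by fun_prop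
      refine hc.tendsto 0 |>.eventually_const_lt ?_
      simp
      positivity
    have h1 : ∀ᶠ δ in nhds (0 : ℝ), δ < 1 := eventually_lt_nhds one_pos
    filter_upwards [self_mem_nhdsWithin, hpos.filter_mono nhdsWithin_le_nhds,
      h1.filter_mono nhdsWithin_le_nhds] with δ (hδ : 0 < δ) hQ hδ1
    have h2 := (h δ hδ1).2
    have h3 : 0 < 1 - descentParam m q δ := by
      rw [h2]
      have : 0 < 1 - δ := by linarith
      have h4 : 0 < 1 / q - (m + 1) + (m + 1) * m / 2 * δ
          - (m + 1) * m * (m - 1) / 6 * δ ^ 2 + δ ^ 3 * R δ := by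
        nlinarith [mul_pos hδ hQ]
      positivity
    exact sub_pos.1 h3

/-- Eventually, `descentParam` takes values in `(0, 1)` and inverts the generating function. -/
lemma eventually_passageSeries_descentParam (hm : 1 ≤ m) (hp : 0 ≤ p) (hq : 0 < q)
    (hpq : p + q = 1) (hle : (m + 1) * q ≤ 1) :
    ∀ᶠ δ in nhdsWithin (0 : ℝ) (Set.Ioi 0), 0 < δ ∧ δ < 1 ∧ 0 < descentParam m q δ ∧
      descentParam m q δ < 1 ∧ passageSeries m p q (descentParam m q δ) 1 = 1 - δ := by
  have ht := tendsto_nhdsWithin_iff.1 (tendsto_descentParam hq hle hm)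
  have h1 : ∀ᶠ δ in nhds (0 : ℝ), δ < 1 := eventually_lt_nhds one_pos
  filter_upwards [self_mem_nhdsWithin, ht.2, ht.1.eventually_const_lt one_pos,
      h1.filter_mono nhdsWithin_le_nhds] with δ hδ hz1 hz hδ1
  exact ⟨hδ, hδ1, hz, hz1, passageSeries_descentParam hp hq hpq hδ hδ1 hz.le hz1⟩

/-! ### The case `q < 1 / k` -/

/-- The limit of the expected residue, as the value at `z = 1` of a generating function that is
singular there only in appearance. -/
lemma hasSum_gain_of_subcritical (hm : 1 ≤ m) (hp : 0 < p) (hq : 0 < q) (hpq : p + q = 1)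
    (hlt : (m + 1) * q < 1) {S : ℝ} (hS : HasSum (fun n => m - p / q + visitWeight m p q n 0) S) :
    S = m * (2 - (m + 1) * q) / (2 * (1 - (m + 1) * q)) := by
  have hAbel := (Real.tendsto_tsum_powerSeries_nhdsWithin_lt hS.tendsto_sum_nat).comp
    (tendsto_descentParam hq hlt.le hm)
  obtain ⟨R, hR, hexp⟩ := exists_one_sub_descentParam_eq m q
  set α := 1 / q - (m + 1) with hα
  have hα0 : 0 < α := by rw [hα, sub_pos, lt_div_iff₀ hq]; exact hlt
  have hc : (m : ℝ) - p / q = -α := by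
    rw [hα, show p = 1 - q by linarith]; field_simp; ring
  let b : ℝ := (m + 1) * m / 2
  let d : ℝ := (m + 1) * m * (m - 1) / 6
  -- `1 - z = δ Q(δ) / (1 - δ) ^ (m + 1)`, and the poles in `δ` of the two summands cancel.
  let Q : ℝ → ℝ := fun δ => α + b * δ - d * δ ^ 2 + δ ^ 3 * R δ
  let E : ℝ → ℝ := fun δ => -d + δ * R δ - α * b + α * d * δ - α * δ ^ 2 * R δ
  have hQ0 : Q 0 = α := by simp [Q]
  have hQc : Continuous Q := by fun_prop
  have hlim : Tendsto (fun δ => (b + α * (m + 1) + δ * E δ) / Q δ - 1)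
      (nhdsWithin 0 (Set.Ioi 0)) (nhds ((b + α * (m + 1)) / α - 1)) := by
    have hcont : ContinuousAt (fun δ => (b + α * (m + 1) + δ * E δ) / Q δ - 1) 0 := by
      refine ContinuousAt.sub (ContinuousAt.div (by fun_prop) hQc.continuousAt ?_)
        continuousAt_const
      rw [hQ0]; exact hα0.ne'
    have := hcont.tendsto.mono_left (nhdsWithin_le_nhds (s := Set.Ioi 0))
    simpa [hQ0] using this
  have heq : (fun δ => (b + α * (m + 1) + δ * E δ) / Q δ - 1)
      =ᶠ[nhdsWithin 0 (Set.Ioi 0)] (fun x => ∑' n, (m - p / q + visitWeight m p q n 0) * x ^ n)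
        ∘ descentParam m q := by
    have hQpos : ∀ᶠ δ in nhds (0 : ℝ), 0 < Q δ :=
      (hQc.tendsto 0).eventually_const_lt (by rw [hQ0]; exact hα0)
    filter_upwards [eventually_passageSeries_descentParam hm hp.le hq hpq hlt.le,
      hQpos.filter_mono nhdsWithin_le_nhds] with δ ⟨hδ, hδ1, hz, hz1, hh⟩ hQδ
    obtain ⟨hN, h1z⟩ := hexp δ hδ1
    have hsum := hasSum_visitWeight (m := m) hp.le hq hpq hz.le hz1.le (by rw [hh]; linarith)
    have hgeo := (hasSum_geometric_of_lt_one hz.le hz1).mul_left (m - p / q)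
    have htot := (hgeo.add hsum).tsum_eq
    simp only [← add_mul] at htot
    rw [Function.comp_apply, htot, hh, hc, h1z, sub_sub_cancel]
    have hNpos : 0 < (1 - δ) ^ (m + 1) := pow_pos (by linarith) _
    change _ = -α * (δ * Q δ / (1 - δ) ^ (m + 1))⁻¹ + (1 - δ) / δ
    have hN' : (1 - δ) ^ (m + 1) = 1 - (m + 1) * δ + b * δ ^ 2 - d * δ ^ 3 + δ ^ 4 * R δ := hN
    rw [inv_div, hN']
    have hQ' : Q δ = α + b * δ - d * δ ^ 2 + δ ^ 3 * R δ := rfl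
    have hE' : E δ = -d + δ * R δ - α * b + α * d * δ - α * δ ^ 2 * R δ := rfl
    have hQne := hQδ.ne'
    field_simp
    rw [hQ', hE']
    ring
  have hS' := tendsto_nhds_unique hAbel (hlim.congr' heq)
  rw [hS']
  have h1q : 1 - (m + 1) * q ≠ 0 := by linarith
  have hαq : α = (1 - (m + 1) * q) / q := by rw [hα]; field_simp
  rw [hαq]
  simp only [b]
  field_simp
  ring

lemma isBigO_gain_of_subcritical (hm : 1 ≤ m) (hp : 0 < p) (hq : 0 < q) (hpq : p + q = 1)
    (hlt : (m + 1) * q < 1) {ε : ℝ} (hε : 0 < ε) :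
    (fun n => ∑ j ∈ Finset.range n, (m - p / q + visitWeight m p q j 0)
        - m * (2 - (m + 1) * q) / (2 * (1 - (m + 1) * q)))
      =O[atTop] fun n => (1 / critRadius (m + 1) p + ε) ^ n := by
  have hm0 : (0 : ℝ) < m := by exact_mod_cast hm
  have hρ := critRadius_pos hm hp (by linarith : p < 1)
  have hρ1 := one_div_critRadius_lt_one hm hp hq hpq hlt.ne
  have hbound : ∀ n, |m - p / q + visitWeight m p q (n + 1) 0|
      ≤ m * (1 / critRadius (m + 1) p) ^ (n + 1) := by
    intro n
    rw [abs_of_nonneg (add_visitWeight_nonneg hp.le hq hpq n), one_div_critRadius hm hp hpq]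
    refine add_visitWeight_le hp.le hq hpq (by positivity) ?_ n
    rw [div_le_one (by positivity)]
    nlinarith
  have hsum : Summable fun n => m - p / q + visitWeight m p q n 0 := by
    rw [← summable_nat_add_iff 1]
    refine Summable.of_norm_bounded (Summable.mul_left _ ?_) hbound
    exact (summable_nat_add_iff 1).2 (summable_geometric_of_lt_one (by positivity) hρ1)
  have hS := hsum.hasSum
  rw [hasSum_gain_of_subcritical hm hp hq hpq hlt hS] at hS
  exact isBigO_sum_range_sub_of_geometric (by positivity) hρ1 hbound hS hε

end

/-! ### Stirling's formula with relative error `O(1 / n)` -/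

section

open Stirling

lemma stirlingSeq_pos {n : ℕ} (hn : n ≠ 0) : 0 < stirlingSeq n := by
  obtain ⟨n, rfl⟩ := Nat.exists_eq_succ_of_ne_zero hn
  exact stirlingSeq'_pos n

lemma stirlingSeq_le {n : ℕ} (hn : n ≠ 0) : stirlingSeq n ≤ √Real.pi * (1 + 1 / n) := by
  -- `log (stirlingSeq n) - 1 / (12 n)` increases to `log √π`.
  let a : ℕ → ℝ := fun n => Real.log (stirlingSeq (n + 1)) - 1 / (12 * (n + 1 : ℝ))
  have hmono : Monotone a := by
    refine monotone_nat_of_le_succ fun n => ?_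
    have h := log_stirlingSeq_sdiff_le (n + 1)
    have e : 1 / (12 * ((n + 1 : ℕ) : ℝ) * (((n + 1 : ℕ) : ℝ) + 1))
        = 1 / (12 * (n + 1 : ℝ)) - 1 / (12 * ((n + 1 : ℕ) + 1 : ℝ)) := by
      push_cast
      field_simp
      ring
    simp only [a]
    linarith
  have hlim : Tendsto a atTop (nhds (Real.log √Real.pi)) := by
    have h1 : Tendsto (fun n => Real.log (stirlingSeq (n + 1))) atTop
        (nhds (Real.log √Real.pi)) :=
      (Real.continuousAt_log (by positivity)).tendsto.comp
        ((tendsto_add_atTop_iff_nat 1).2 tendsto_stirlingSeq_sqrt_pi)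
    have h2 : Tendsto (fun n : ℕ => 1 / (12 * (n + 1 : ℝ))) atTop (nhds 0) := by
      have := (tendsto_one_div_add_atTop_nhds_zero_nat (𝕜 := ℝ)).const_mul (1 / 12)
      rw [mul_zero] at this
      exact this.congr fun n => by field_simp
    have := h1.sub h2
    rwa [sub_zero] at this
  obtain ⟨n, rfl⟩ := Nat.exists_eq_succ_of_ne_zero hn
  have h := hmono.ge_of_tendsto hlim n
  have hpos := stirlingSeq'_pos n
  have h3 : stirlingSeq (n + 1) ≤ √Real.pi * Real.exp (1 / (12 * (n + 1 : ℝ))) := by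
    rw [← Real.log_le_log_iff hpos (by positivity), Real.log_mul (by positivity) (by positivity),
      Real.log_exp]
    simp only [a] at h
    linarith
  refine h3.trans ?_
  gcongr
  have hx0 : 0 ≤ 1 / (12 * (n + 1 : ℝ)) := by positivity
  have hx1 : 1 / (12 * (n + 1 : ℝ)) ≤ 1 / 12 := by
    apply one_div_le_one_div_of_le (by norm_num)
    have : (0 : ℝ) ≤ n := Nat.cast_nonneg n
    linarith
  have h4 := Real.exp_bound_div_one_sub_of_interval hx0 (by linarith)
  refine h4.trans ?_
  rw [div_le_iff₀ (by linarith)]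
  have h5 : 1 / (12 * (n + 1 : ℝ)) = 1 / ((n + 1 : ℕ) : ℝ) / 12 := by push_cast; field_simp
  have h6 : 1 / ((n + 1 : ℕ) : ℝ) ≤ 1 := by
    rw [div_le_one (by positivity)]; push_cast; linarith [(Nat.cast_nonneg n : (0 : ℝ) ≤ n)]
  have h7 : 0 ≤ 1 / ((n + 1 : ℕ) : ℝ) := by positivity
  rw [h5]
  simp only [Nat.succ_eq_add_one]
  nlinarith

/-- The ratio of Stirling factors in the binomial coefficient `((m + 1) n).choose n`. -/
noncomputable def stirlingRatio (m n : ℕ) : ℝ :=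
  stirlingSeq ((m + 1) * n) / (stirlingSeq n * stirlingSeq (m * n))

lemma abs_stirlingRatio_sub_le {m n : ℕ} (hm : 1 ≤ m) (hn : n ≠ 0) :
    |stirlingRatio m n - 1 / √Real.pi| ≤ 3 / n := by
  have hmn : m * n ≠ 0 := mul_ne_zero (by omega) hn
  have hkn : (m + 1) * n ≠ 0 := mul_ne_zero (by omega) hn
  have hn0 : (0 : ℝ) < n := by exact_mod_cast Nat.pos_of_ne_zero hn
  have hs1 : 1 ≤ √Real.pi := by
    rw [Real.one_le_sqrt]; linarith [Real.pi_gt_three]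
  have hs0 : 0 < √Real.pi := by linarith
  have hup : ∀ j : ℕ, n ≤ j → stirlingSeq j ≤ √Real.pi * (1 + 1 / n) := fun j hj => by
    refine (stirlingSeq_le (by omega)).trans ?_
    gcongr
  have ha := sqrt_pi_le_stirlingSeq hkn
  have ha' := hup ((m + 1) * n) (Nat.le_mul_of_pos_left n (by omega))
  have hb := sqrt_pi_le_stirlingSeq hn
  have hb' := hup n le_rfl
  have hc := sqrt_pi_le_stirlingSeq hmn
  have hc' := hup (m * n) (Nat.le_mul_of_pos_left n hm)
  rw [stirlingRatio]
  set s := √Real.pi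
  set x : ℝ := 1 / n with hx
  have hx0 : 0 < x := by positivity
  have hx1 : x ≤ 1 := by
    rw [hx, div_le_one hn0]; exact_mod_cast Nat.one_le_iff_ne_zero.2 hn
  have hb0 : 0 < stirlingSeq n := stirlingSeq_pos hn
  have hc0 : 0 < stirlingSeq (m * n) := stirlingSeq_pos hmn
  have hupper : stirlingSeq ((m + 1) * n) / (stirlingSeq n * stirlingSeq (m * n))
      ≤ 1 / s * (1 + x) := by
    calc _ ≤ s * (1 + x) / (s * s) := by gcongr
      _ = _ := by field_simp
  have hlower : 1 / s * (1 / (1 + x) ^ 2)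
      ≤ stirlingSeq ((m + 1) * n) / (stirlingSeq n * stirlingSeq (m * n)) := by
    calc _ = s / ((s * (1 + x)) * (s * (1 + x))) := by field_simp
      _ ≤ _ := by
        have := hs0.le.trans ha
        gcongr
  have hbern : 1 - 2 * x ≤ 1 / (1 + x) ^ 2 := by
    rw [le_div_iff₀ (by positivity)]
    nlinarith [sq_nonneg x, mul_pos hx0 hx0, mul_pos hx0 (mul_pos hx0 hx0)]
  have hs' : 1 / s ≤ 1 := by rw [div_le_one hs0]; exact hs1
  have hs'' : 0 < 1 / s := by positivity
  rw [show (3 : ℝ) / n = 3 * x by rw [hx]; ring, abs_le]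
  constructor
  · have : 1 / s * (1 - 2 * x) ≤ 1 / s * (1 / (1 + x) ^ 2) := by gcongr
    nlinarith
  · nlinarith

lemma factorial_eq_stirlingSeq_mul {n : ℕ} (hn : n ≠ 0) :
    (n.factorial : ℝ) = stirlingSeq n * (√(2 * n) * (n / Real.exp 1) ^ n) := by
  have hn0 : (0 : ℝ) < n := by exact_mod_cast Nat.pos_of_ne_zero hn
  rw [stirlingSeq, div_mul_cancel₀ _ (by positivity)]

end

/-! ### The case `q = 1 / k` -/

section

variable {m : ℕ} {p q : ℝ}

lemma visitWeight_of_critical_eq_stirlingRatio (hm : 1 ≤ m) (hq : 0 < q) (hpq : p + q = 1)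
    (hcrit : p = m * q) {n : ℕ} (hn : n ≠ 0) :
    visitWeight m p q n 0 = √((m + 1) * m / 2) * (stirlingRatio m n / √n) := by
  have hm0 : (0 : ℝ) < m := by exact_mod_cast hm
  have hn0 : (0 : ℝ) < n := by exact_mod_cast Nat.pos_of_ne_zero hn
  have hmn : m * n ≠ 0 := mul_ne_zero (by omega) hn
  have hkn : (m + 1) * n ≠ 0 := mul_ne_zero (by omega) hn
  have hq' : q = 1 / (m + 1) := by
    rw [hcrit] at hpq
    field_simp
    linarith
  rw [visitWeight_of_critical (by rw [hcrit]; positivity) hq hpq hcrit]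
  have hch : (((m + 1) * n).choose n : ℝ)
      = ((m + 1) * n).factorial / (n.factorial * (m * n).factorial) := by
    rw [Nat.cast_choose ℝ (Nat.le_mul_of_pos_left n (by omega)),
      show (m + 1) * n - n = m * n by rw [add_mul, one_mul, Nat.add_sub_cancel]]
  have hb0 := stirlingSeq_pos hn
  have hc0 := stirlingSeq_pos hmn
  have hsq : √((m + 1) * m / 2) * (√(2 * n) * √(2 * (m * n)))
      = m * √(2 * ((m + 1) * n)) * √n := by
    rw [← Real.sqrt_mul (by positivity), ← Real.sqrt_mul (by positivity),
      mul_assoc (m : ℝ), ← Real.sqrt_mul (by positivity)]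
    rw [show ((m : ℝ) + 1) * m / 2 * (2 * n * (2 * (m * n)))
      = (m : ℝ) ^ 2 * (2 * ((m + 1) * n) * n) by ring, Real.sqrt_mul (by positivity),
      Real.sqrt_sq hm0.le]
  rw [hch, factorial_eq_stirlingSeq_mul hn, factorial_eq_stirlingSeq_mul hmn,
    factorial_eq_stirlingSeq_mul hkn, stirlingRatio, hcrit, hq']
  push_cast
  have hpow : ((m + 1) * n / Real.exp 1) ^ ((m + 1) * n) * (m * (1 / ((m : ℝ) + 1))) ^ (m * n)
      * (1 / ((m : ℝ) + 1)) ^ n = (n / Real.exp 1) ^ n * (m * n / Real.exp 1) ^ (m * n) := by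
    rw [show (m + 1) * n = n + m * n by ring, pow_add]
    calc _ = (((m + 1) * n / Real.exp 1) * (1 / ((m : ℝ) + 1))) ^ n
          * (((m + 1) * n / Real.exp 1) * (m * (1 / ((m : ℝ) + 1)))) ^ (m * n) := by
          rw [mul_pow _ (1 / ((m : ℝ) + 1)) n, mul_pow _ (m * (1 / ((m : ℝ) + 1))) (m * n)]
          ring
      _ = _ := by
          congr 2 <;> field_simp
  have hN : √(n : ℝ) ≠ 0 := by positivity
  have hB : √(2 * (n : ℝ)) ≠ 0 := by positivity
  have hD : √(2 * (m * (n : ℝ))) ≠ 0 := by positivity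
  have hY : (n / Real.exp 1) ^ n ≠ 0 := by positivity
  have hZ : (m * n / Real.exp 1) ^ (m * n) ≠ 0 := by positivity
  generalize √((m + 1) * m / 2 : ℝ) = r at *
  generalize √(n : ℝ) = N at *
  generalize √(2 * (n : ℝ)) = B at *
  generalize √(2 * (m * (n : ℝ))) = D at *
  generalize √(2 * (((m : ℝ) + 1) * n)) = A at *
  generalize (n / Real.exp 1) ^ n = Y at *
  generalize (m * n / Real.exp 1) ^ (m * n) = Z at *
  generalize ((m + 1) * n / Real.exp 1) ^ ((m + 1) * n) = X at *
  generalize (m * (1 / ((m : ℝ) + 1))) ^ (m * n) = P at *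
  generalize (1 / ((m : ℝ) + 1)) ^ n = Q at *
  have hbne := hb0.ne'
  have hcne := hc0.ne'
  field_simp
  linear_combination Stirling.stirlingSeq ((m + 1) * n) * m * A * N * hpow
    - Stirling.stirlingSeq ((m + 1) * n) * Y * Z * hsq

/-- A series whose terms are dominated by the decrements of a nonnegative sequence converges, with
the sequence as error bound. -/
lemma exists_hasSum_of_abs_le_sub {f g : ℕ → ℝ} (hg : ∀ n, 0 ≤ g n)
    (h : ∀ n, |f n| ≤ g n - g (n + 1)) :
    ∃ S, HasSum f S ∧ ∀ n, |∑ j ∈ Finset.range n, f j - S| ≤ g n := by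
  have hpart : ∀ n N, ∑ j ∈ Finset.range N, |f (n + j)| ≤ g n := by
    intro n N
    have h1 : ∑ j ∈ Finset.range N, |f (n + j)| ≤ g n - g (n + N) := by
      induction N with
      | zero => simp
      | succ N ih =>
        rw [Finset.sum_range_succ, ← add_assoc]
        linarith [h (n + N)]
    linarith [hg (n + N)]
  have habs : Summable fun n => |f n| :=
    summable_of_sum_range_le (fun n => abs_nonneg _) fun N => by simpa using hpart 0 N
  have hs : Summable f := habs.of_abs
  refine ⟨_, hs.hasSum, fun n => ?_⟩
  rw [← hs.sum_add_tsum_nat_add n, sub_add_cancel_left, abs_neg]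
  have hs' : Summable fun j => |f (j + n)| := (summable_nat_add_iff n).2 habs
  have hle : |∑' j, f (j + n)| ≤ ∑' j, |f (j + n)| :=
    norm_tsum_le_tsum_norm (f := fun j => f (j + n)) hs'
  refine hle.trans (hs'.tsum_le_of_sum_range_le fun N => ?_)
  simpa [add_comm] using hpart n N

lemma one_div_mul_sqrt_le (n : ℕ) :
    1 / ((n + 1 : ℝ) * √(n + 1)) ≤ 8 * (1 / √(n + 1 : ℝ)) - 8 * (1 / √((n + 1 : ℕ) + 1 : ℝ)) := by
  have hx : 0 < √(n + 1 : ℝ) := by positivity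
  have hy : 0 < √((n + 1 : ℕ) + 1 : ℝ) := by positivity
  have hx2 : √(n + 1 : ℝ) ^ 2 = n + 1 := Real.sq_sqrt (by positivity)
  have hy2 : √((n + 1 : ℕ) + 1 : ℝ) ^ 2 = √(n + 1 : ℝ) ^ 2 + 1 := by
    rw [hx2, Real.sq_sqrt (by positivity)]; push_cast; ring
  have hx1 : 1 ≤ √(n + 1 : ℝ) := by
    rw [Real.one_le_sqrt]; linarith [(Nat.cast_nonneg n : (0 : ℝ) ≤ n)]
  generalize √(n + 1 : ℝ) = x at *
  generalize √((n + 1 : ℕ) + 1 : ℝ) = y at *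
  rw [← hx2]
  have hyx : y ≤ 2 * x := by nlinarith
  have hxy : x ≤ y := by nlinarith
  have hprod : (y - x) * (y + x) = 1 := by linear_combination hy2
  have h1 : 1 ≤ (y - x) * (3 * x) := by nlinarith
  rw [← mul_sub 8, div_sub_div _ _ hx.ne' hy.ne', mul_div_assoc', div_le_div_iff₀ (by positivity)
    (by positivity)]
  have h2 : y ≤ 8 * (y - x) * x ^ 2 := by nlinarith
  nlinarith [mul_le_mul_of_nonneg_left h2 hx.le]

/-- The critical weights for `k = 2` have generating function `1 / √(1 - z)`. -/
lemma hasSum_visitWeight_one {z : ℝ} (hz : 0 ≤ z) (hz1 : z < 1) :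
    HasSum (fun n => visitWeight 1 (1 / 2) (1 / 2) n 0 * z ^ n) (1 / √(1 - z)) := by
  have hs : 0 < √(1 - z) := Real.sqrt_pos.2 (by linarith)
  have hs2 : √(1 - z) ^ 2 = 1 - z := Real.sq_sqrt (by linarith)
  have hhalf : (0 : ℝ) < 1 / 2 := by norm_num
  have hlt := passageSeries_one_lt_one (m := 1) hhalf.le hhalf (by norm_num) hz hz1
  have h : passageSeries 1 (1 / 2) (1 / 2) z 1 = 1 / (1 + √(1 - z)) := by
    refine eq_of_passage_equation hhalf (by norm_num) hz hz1
      (passageSeries_nonneg hhalf.le hhalf.le hz 1) hlt (by positivity) ?_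
      (passageSeries_one (m := 1) hhalf.le hhalf.le (by norm_num) hz hz1.le) ?_
    · rw [div_lt_one (by positivity)]; linarith
    · rw [div_pow]
      field_simp
      linear_combination (-1 - √(1 - z)) * hs2
  have hsum := hasSum_visitWeight (m := 1) hhalf.le hhalf (by norm_num) hz hz1.le hlt
  rw [h] at hsum
  convert hsum using 1
  have : 1 + √(1 - z) - 1 ≠ 0 := by rw [add_sub_cancel_left]; exact hs.ne'
  field_simp
  ring

lemma visitWeight_one_eq_stirlingRatio {n : ℕ} (hn : n ≠ 0) :
    visitWeight 1 (1 / 2) (1 / 2) n 0 = stirlingRatio 1 n / √n := by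
  rw [visitWeight_of_critical_eq_stirlingRatio (m := 1) le_rfl (by norm_num) (by norm_num)
    (by norm_num) hn]
  norm_num

/-- The partial sums of `C(2 n, n) / 4 ^ n` have a closed form. -/
lemma sum_visitWeight_one (n : ℕ) :
    ∑ j ∈ Finset.range n, visitWeight 1 (1 / 2) (1 / 2) j 0
      = 2 * n * visitWeight 1 (1 / 2) (1 / 2) n 0 := by
  have hv : ∀ n, visitWeight 1 (1 / 2) (1 / 2) n 0 = n.centralBinom * (1 / 4 : ℝ) ^ n := by
    intro n
    rw [visitWeight_of_critical (by norm_num) (by norm_num) (by norm_num) (by norm_num),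
      Nat.centralBinom, mul_assoc _ ((1 / 2 : ℝ) ^ _), one_mul, ← mul_pow]
    norm_num
  induction n with
  | zero => simp
  | succ n ih =>
    have h : ((n : ℝ) + 1) * (n + 1).centralBinom = 2 * (2 * n + 1) * n.centralBinom := by
      exact_mod_cast Nat.succ_mul_centralBinom_succ n
    rw [Finset.sum_range_succ, ih, hv, hv]
    push_cast
    rw [pow_succ]
    linear_combination (-(1 / 2 : ℝ) * (1 / 4) ^ n) * h

lemma abs_visitWeight_sub_le (hm : 1 ≤ m) (hq : 0 < q) (hpq : p + q = 1) (hcrit : p = m * q)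
    (n : ℕ) :
    |visitWeight m p q (n + 1) 0 - √((m + 1) * m / 2) * visitWeight 1 (1 / 2) (1 / 2) (n + 1) 0|
      ≤ √((m + 1) * m / 2) * 6 * (1 / ((n + 1 : ℝ) * √(n + 1))) := by
  have h1 := abs_stirlingRatio_sub_le hm n.succ_ne_zero
  have h2 := abs_stirlingRatio_sub_le le_rfl n.succ_ne_zero
  rw [visitWeight_of_critical_eq_stirlingRatio hm hq hpq hcrit n.succ_ne_zero,
    visitWeight_one_eq_stirlingRatio n.succ_ne_zero, ← mul_sub, ← sub_div, abs_mul, abs_div,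
    abs_of_nonneg (Real.sqrt_nonneg _), abs_of_nonneg (Real.sqrt_nonneg _), mul_assoc]
  simp only [Nat.succ_eq_add_one] at *
  push_cast at *
  gcongr
  have h3 : |stirlingRatio m (n + 1) - stirlingRatio 1 (n + 1)| ≤ 6 / (n + 1 : ℝ) := by
    calc _ ≤ |stirlingRatio m (n + 1) - 1 / √Real.pi|
          + |1 / √Real.pi - stirlingRatio 1 (n + 1)| := abs_sub_le _ _ _
      _ ≤ 3 / (n + 1) + 3 / (n + 1) := by rw [abs_sub_comm (1 / √Real.pi)]; gcongr
      _ = _ := by ring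
  calc _ ≤ 6 / (n + 1 : ℝ) / √(n + 1) := by gcongr
    _ = _ := by field_simp

/-- The constant term, read off at the common singularity `z = 1` of the two generating
functions. -/
lemma hasSum_visitWeight_sub (hm : 1 ≤ m) (hp : 0 < p) (hq : 0 < q) (hpq : p + q = 1)
    (hcrit : p = m * q) {S : ℝ}
    (hS : HasSum (fun n => visitWeight m p q n 0
      - √((m + 1) * m / 2) * visitWeight 1 (1 / 2) (1 / 2) n 0) S) :
    S = (m - 1) / 3 := by
  have hm0 : (0 : ℝ) < m := by exact_mod_cast hm
  have hkq : (m + 1) * q = 1 := by linarith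
  have hAbel := (Real.tendsto_tsum_powerSeries_nhdsWithin_lt hS.tendsto_sum_nat).comp
    (tendsto_descentParam hq hkq.le hm)
  obtain ⟨R, hR, hexp⟩ := exists_one_sub_descentParam_eq m q
  have hα : 1 / q - ((m : ℝ) + 1) = 0 := by
    rw [sub_eq_zero, div_eq_iff hq.ne', hkq]
  let b : ℝ := (m + 1) * m / 2
  let d : ℝ := (m + 1) * m * (m - 1) / 6
  have hb0 : 0 < b := by positivity
  -- `1 - z = δ ^ 2 Q(δ) / (1 - δ) ^ (m + 1) = δ ^ 2 b / X(δ)`, and the poles in `δ` cancel.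
  let Q : ℝ → ℝ := fun δ => b - d * δ + δ ^ 2 * R δ
  let E : ℝ → ℝ := fun δ => R δ - b * b + b * d * δ - b * δ ^ 2 * R δ
  let X : ℝ → ℝ := fun δ => b * (1 - δ) ^ (m + 1) / Q δ
  have hQ0 : Q 0 = b := by simp [Q]
  have hX0 : X 0 = 1 := by simp [X, hQ0, hb0.ne']
  have hQc : Continuous Q := by fun_prop
  have hXc : ContinuousAt X 0 :=
    ContinuousAt.div (by fun_prop) hQc.continuousAt (by rw [hQ0]; exact hb0.ne')
  let G : ℝ → ℝ := fun δ => (b * (m + 1) - d + δ * E δ) / (Q δ * (1 + √(X δ))) - 1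
  have hlim : Tendsto G (nhdsWithin 0 (Set.Ioi 0)) (nhds ((b * (m + 1) - d) / (b * 2) - 1)) := by
    have hcont : ContinuousAt G 0 := by
      refine ContinuousAt.sub (ContinuousAt.div (by fun_prop)
        (hQc.continuousAt.mul (continuousAt_const.add hXc.sqrt)) ?_) continuousAt_const
      rw [hQ0, hX0, Real.sqrt_one]
      positivity
    have := hcont.tendsto.mono_left (nhdsWithin_le_nhds (s := Set.Ioi 0))
    have e : G 0 = (b * (m + 1) - d) / (b * 2) - 1 := by
      simp only [G, hQ0, hX0, Real.sqrt_one, zero_mul, add_zero]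
      norm_num
    rwa [e] at this
  have heq : G =ᶠ[nhdsWithin 0 (Set.Ioi 0)] (fun x => ∑' n, (visitWeight m p q n 0
      - √((m + 1) * m / 2) * visitWeight 1 (1 / 2) (1 / 2) n 0) * x ^ n)
        ∘ descentParam m q := by
    have hQpos : ∀ᶠ δ in nhds (0 : ℝ), 0 < Q δ :=
      (hQc.tendsto 0).eventually_const_lt (by rw [hQ0]; exact hb0)
    filter_upwards [eventually_passageSeries_descentParam hm hp.le hq hpq hkq.le,
      hQpos.filter_mono nhdsWithin_le_nhds] with δ ⟨hδ, hδ1, hz, hz1, hh⟩ hQδ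
    obtain ⟨hN, h1z⟩ := hexp δ hδ1
    have hsum := hasSum_visitWeight (m := m) hp.le hq hpq hz.le hz1.le (by rw [hh]; linarith)
    have hone := (hasSum_visitWeight_one hz.le hz1).mul_left √((m + 1) * m / 2)
    have htot := (hsum.sub hone).tsum_eq
    simp only [← mul_assoc, ← sub_mul] at htot
    rw [Function.comp_apply, htot, hh, sub_sub_cancel]
    have hNpos : 0 < (1 - δ) ^ (m + 1) := pow_pos (by linarith) _
    have hXpos : 0 < X δ := by positivity
    have h1z' : 1 - descentParam m q δ = δ ^ 2 * (b / X δ) := by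
      rw [h1z, hα]
      simp only [X, Q, b, d] at hQδ ⊢
      field_simp
      ring
    have hsqrt : √((m + 1) * m / 2) * (1 / √(1 - descentParam m q δ)) = √(X δ) / δ := by
      change √b * _ = _
      have : 0 < √b := Real.sqrt_pos.2 hb0
      have : 0 < √(X δ) := Real.sqrt_pos.2 hXpos
      rw [h1z', Real.sqrt_mul (by positivity), Real.sqrt_sq hδ.le, Real.sqrt_div hb0.le]
      field_simp
    rw [hsqrt]
    have hX2 : √(X δ) ^ 2 = X δ := Real.sq_sqrt hXpos.le
    have hX1 : (1 - X δ) * Q δ = δ * (b * (m + 1) - d + δ * E δ) := by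
      have : X δ * Q δ = b * (1 - δ) ^ (m + 1) := div_mul_cancel₀ _ hQδ.ne'
      rw [sub_mul, this, hN]
      simp only [E, Q, b, d]
      ring
    have hs0 : 0 ≤ √(X δ) := Real.sqrt_nonneg _
    have hne : Q δ * (1 + √(X δ)) ≠ 0 := by positivity
    simp only [G]
    rw [div_sub_div_same, sub_eq_iff_eq_add, div_add_one hδ.ne', div_eq_div_iff hne hδ.ne']
    linear_combination (-1 : ℝ) * hX1 + Q δ * hX2
  have hS' := tendsto_nhds_unique hAbel (hlim.congr' heq)
  rw [hS']
  simp only [b, d]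
  field_simp
  ring

/-- The second-order asymptotics in the critical case. -/
lemma isBigO_visits_of_critical (hm : 1 ≤ m) (hp : 0 < p) (hq : 0 < q) (hpq : p + q = 1)
    (hcrit : p = m * q) :
    (fun n : ℕ => ∑ j ∈ Finset.range n, visitWeight m p q j 0
        - (√(2 * (m + 1) * m * n / Real.pi) + (m - 1) / 3))
      =O[atTop] fun n : ℕ => 1 / √(n : ℝ) := by
  set A := √(((m : ℝ) + 1) * m / 2) with hA
  have hA0 : 0 ≤ A := Real.sqrt_nonneg _
  let v : ℕ → ℝ := fun n => visitWeight 1 (1 / 2) (1 / 2) n 0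
  let f : ℕ → ℝ := fun n => visitWeight m p q n 0 - A * v n
  let g : ℕ → ℝ := fun n => A * 6 * (8 * (1 / √(n + 1 : ℝ)))
  obtain ⟨S, hS, hbound⟩ := exists_hasSum_of_abs_le_sub (f := fun n => f (n + 1)) (g := g)
    (fun n => by positivity) fun n => by
      refine (abs_visitWeight_sub_le hm hq hpq hcrit n).trans ?_
      have := mul_le_mul_of_nonneg_left (one_div_mul_sqrt_le n) (by positivity : 0 ≤ A * 6)
      simp only [g]
      linarith
  have hS1 : HasSum f (S + f 0) := by
    rw [← hasSum_nat_add_iff' 1]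
    simpa using hS
  have hSval := hasSum_visitWeight_sub hm hp hq hpq hcrit hS1
  refine IsBigO.of_bound (A * 48 + A * 6) ?_
  filter_upwards [eventually_ge_atTop 1] with n hn
  obtain ⟨n, rfl⟩ := Nat.exists_eq_succ_of_ne_zero (by omega : n ≠ 0)
  simp only [Nat.succ_eq_add_one]
  have hpi : 0 < √Real.pi := Real.sqrt_pos.2 Real.pi_pos
  have hN0 : 0 < √((n + 1 : ℕ) : ℝ) := Real.sqrt_pos.2 (by positivity)
  have hN2 : √((n + 1 : ℕ) : ℝ) ^ 2 = ((n + 1 : ℕ) : ℝ) := Real.sq_sqrt (by positivity)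
  have e1 : √(2 * (m + 1) * m * ((n + 1 : ℕ) : ℝ) / Real.pi)
      = A * (2 * √((n + 1 : ℕ) : ℝ) * (1 / √Real.pi)) := by
    rw [hA, show 2 * ((m : ℝ) + 1) * m * ((n + 1 : ℕ) : ℝ) / Real.pi
      = ((m + 1) * m / 2) * (2 ^ 2 * ((n + 1 : ℕ) : ℝ) * (1 / Real.pi)) by ring,
      Real.sqrt_mul (by positivity), Real.sqrt_mul (by positivity), Real.sqrt_mul (by positivity),
      Real.sqrt_sq (by norm_num), Real.sqrt_div zero_le_one, Real.sqrt_one]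
  have e2 : ∑ j ∈ Finset.range (n + 1), visitWeight m p q j 0
      = ∑ j ∈ Finset.range (n + 1), f j + A * (2 * (n + 1 : ℕ) * v (n + 1)) := by
    rw [← sum_visitWeight_one, Finset.mul_sum, ← Finset.sum_add_distrib]
    exact Finset.sum_congr rfl fun j _ => by simp only [f, v]; ring
  have e3 : 2 * ((n + 1 : ℕ) : ℝ) * v (n + 1)
      = 2 * √((n + 1 : ℕ) : ℝ) * stirlingRatio 1 (n + 1) := by
    simp only [v]
    rw [visitWeight_one_eq_stirlingRatio n.succ_ne_zero, Nat.succ_eq_add_one]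
    nth_rewrite 1 [← hN2]
    field_simp
  have e4 : ∑ j ∈ Finset.range (n + 1), f j - (m - 1) / 3
      = ∑ j ∈ Finset.range n, f (j + 1) - S := by
    rw [Finset.sum_range_succ', ← hSval]
    ring
  have h5 := hbound n
  have h6 := abs_stirlingRatio_sub_le le_rfl n.succ_ne_zero
  rw [Nat.succ_eq_add_one] at h6
  have hsplit : ∑ j ∈ Finset.range (n + 1), visitWeight m p q j 0
        - (√(2 * (m + 1) * m * ((n + 1 : ℕ) : ℝ) / Real.pi) + (m - 1) / 3)
      = (∑ j ∈ Finset.range n, f (j + 1) - S)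
        + A * (2 * √((n + 1 : ℕ) : ℝ)) * (stirlingRatio 1 (n + 1) - 1 / √Real.pi) := by
    rw [← e4, e1, e2, e3]
    ring
  rw [hsplit, Real.norm_eq_abs, Real.norm_of_nonneg (by positivity)]
  refine (abs_add_le _ _).trans ?_
  rw [add_mul]
  refine add_le_add (h5.trans (le_of_eq ?_)) ?_
  · simp only [g]
    push_cast
    ring
  · rw [abs_mul, abs_of_nonneg (by positivity)]
    calc _ ≤ A * (2 * √((n + 1 : ℕ) : ℝ)) * (3 / ((n + 1 : ℕ) : ℝ)) := by gcongr
      _ = _ := by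
        nth_rewrite 2 [← hN2]
        field_simp
        ring

end

theorem theorem3 (k : ℕ) (hk : 2 ≤ k) (p q : ℝ) (hp0 : 0 < p) (hp1 : p < 1) (hq : q = 1 - p)
    {Ω : Type*} [MeasurableSpace Ω] (μ : Measure Ω) [IsProbabilityMeasure μ]
    (ξ : ℕ → Ω → Bool) (hmeas : ∀ t, Measurable (ξ t)) (hindep : iIndepFun ξ μ)
    (hlaw : ∀ t, μ.real {ω | ξ t ω = true} = p)
    (big little : (Fin k → ℕ) → Fin k) (hbig : IsBigRule big) (hlittle : IsLittleRule little) :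
    (1 / (k : ℝ) < q →
      returnProb k p ∈ Set.Ioo (0 : ℝ) 1 ∧
      ∀ ε : ℝ, 0 < ε →
        (fun n : ℕ => expectedResidue μ ξ big little n -
            (((k : ℝ) - 1 / q) * n + p / q * (1 / (1 - returnProb k p))))
          =O[atTop] fun n : ℕ => (1 / critRadius k p + ε) ^ n) ∧
    (q = 1 / (k : ℝ) →
      (fun n : ℕ => expectedResidue μ ξ big little n)
          ~[atTop] (fun n : ℕ => Real.sqrt (2 * k * ((k : ℝ) - 1) * n / Real.pi)) ∧
      (fun n : ℕ => expectedResidue μ ξ big little n -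
            (Real.sqrt (2 * k * ((k : ℝ) - 1) * n / Real.pi) + ((k : ℝ) - 2) / 3))
          =O[atTop] fun n : ℕ => 1 / (n : ℝ) ^ (1 / 2 : ℝ)) ∧
    (q < 1 / (k : ℝ) →
      ∀ ε : ℝ, 0 < ε →
        (fun n : ℕ => expectedResidue μ ξ big little n -
            ((k : ℝ) - 1) * (2 - k * q) / (2 * (1 - k * q)))
          =O[atTop] fun n : ℕ => (1 / critRadius k p + ε) ^ n) := by
  obtain ⟨m, rfl⟩ : ∃ m, k = m + 1 := ⟨k - 1, by omega⟩
  have hm : 1 ≤ m := by omega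
  have hm0 : (0 : ℝ) < m := by exact_mod_cast hm
  have hq0 : 0 < q := by linarith
  have hpq : p + q = 1 := by linarith
  have hM : ∀ n, expectedResidue μ ξ big little n
      = n * ((m : ℝ) + 1 - 1 / q) + ∑ j ∈ Finset.range n, visitWeight m p q j 0 :=
    expectedResidue_eq hmeas hindep hlaw hp0.le hq0 hpq hbig hlittle
  have hk0 : (0 : ℝ) < m + 1 := by positivity
  push_cast
  refine ⟨fun h => ?_, fun h => ?_, fun h ε hε => ?_⟩
  · have hlt : 1 < (m + 1) * q := by
      rw [div_lt_iff₀ hk0] at h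
      linarith
    refine ⟨returnProb_mem_Ioo hm hp0 hq0 hpq hlt, fun ε hε => ?_⟩
    refine (isBigO_visits_of_supercritical hm hp0 hq0 hpq hlt hε).congr_left fun n => ?_
    rw [hM]
    ring
  · have hkq : q * (m + 1) = 1 := (eq_div_iff hk0.ne').1 h
    have hcrit : p = m * q := by linarith
    have hdrift : (m : ℝ) + 1 - 1 / q = 0 := by
      rw [h, one_div_one_div, sub_self]
    have hO := isBigO_visits_of_critical hm hp0 hq0 hpq hcrit
    have hsecond : (fun n : ℕ => expectedResidue μ ξ big little n -
        (√(2 * ((m : ℝ) + 1) * ((m : ℝ) + 1 - 1) * n / Real.pi) + ((m : ℝ) + 1 - 2) / 3))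
          =O[atTop] fun n : ℕ => 1 / (n : ℝ) ^ (1 / 2 : ℝ) := by
      simp only [← Real.sqrt_eq_rpow]
      refine hO.congr_left fun n => ?_
      rw [hM, hdrift, add_sub_cancel_right]
      ring
    refine ⟨?_, hsecond⟩
    -- The constant and the error term are negligible against the diverging main term.
    have hdiv : Tendsto (fun n : ℕ => √(2 * ((m : ℝ) + 1) * ((m : ℝ) + 1 - 1) * n / Real.pi))
        atTop atTop := by
      have e : ∀ n : ℕ, 2 * ((m : ℝ) + 1) * ((m : ℝ) + 1 - 1) * n / Real.pi
          = (2 * (m + 1) * m / Real.pi) * n := fun n => by ring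
      simp only [e]
      exact Real.tendsto_sqrt_atTop.comp
        (tendsto_natCast_atTop_atTop.const_mul_atTop (by positivity))
    have hdiv' : Tendsto (norm ∘ fun n : ℕ =>
        √(2 * ((m : ℝ) + 1) * ((m : ℝ) + 1 - 1) * n / Real.pi)) atTop atTop :=
      tendsto_norm_atTop_atTop.comp hdiv
    have hzero : Tendsto (fun n : ℕ => 1 / (n : ℝ) ^ (1 / 2 : ℝ)) atTop (nhds 0) := by
      simp only [one_div]
      exact ((tendsto_rpow_atTop (by norm_num)).comp
        tendsto_natCast_atTop_atTop).inv_tendsto_atTop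
    have h1 := (hsecond.trans_tendsto hzero).isBigO_one ℝ
    have h2 := h1.add (isBigO_const_const (((m : ℝ) + 1 - 2) / 3) one_ne_zero atTop)
    refine IsLittleO.congr_left (f₁ := fun n : ℕ => expectedResidue μ ξ big little n -
        (√(2 * ((m : ℝ) + 1) * ((m : ℝ) + 1 - 1) * n / Real.pi) + ((m : ℝ) + 1 - 2) / 3)
        + ((m : ℝ) + 1 - 2) / 3) ?_ fun n => by simp only [Pi.sub_apply]; ring
    exact h2.trans_isLittleO ((isLittleO_const_left.2 (Or.inr hdiv')))
  · have hlt : (m + 1) * q < 1 := by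
      rw [lt_div_iff₀ hk0] at h
      linarith
    have hdrift : (m : ℝ) + 1 - 1 / q = m - p / q := by
      rw [show p = 1 - q by linarith]
      field_simp
      ring
    refine (isBigO_gain_of_subcritical hm hp0 hq0 hpq hlt hε).congr_left fun n => ?_
    rw [hM, hdrift, Finset.sum_add_distrib, Finset.sum_const, Finset.card_range, nsmul_eq_mul,
      add_sub_cancel_right]
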